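/- Let $p$ be a prime, $k$ a field of characteristic $p$, $P$ a non-trivial finite abelian $p$-group, and $E$ a finite group of order prime to $p$ acting on $P$ by group automorphisms (not necessarily faithfully). Write $C_E(P)$ for the kernel of the action, $[P,E]$ for the subgroup of $P$ generated by the elements $({}^e u)u^{-1}$ with $u\in P$, $e\in E$, and $\Phi(P)$ for the Frattini subgroup of $P$; the action of $E$ makes $P/\Phi(P)$ an $\mathbb{F}_pE$-module. For a $k$-algebra $A$, regard $\mathrm{HH}^1(A)=\mathrm{Der}(A)/\mathrm{IDer}(A)$, the space of $k$-linear derivations of $A$ modulo inner derivations, as a Lie algebra with bracket induced by $[f,g]=f\circ g-g\circ f$, and let $J(A)$ be the Jacobson radical of $A$. A module is called multiplicity free if it is a direct sum of pairwise non-isomorphic simple modules. Suppose that $[P,E]=P$, that $C_E(P)\le Z(E)$ and that $E/C_E(P)$ is abelian. Then: 1. Every class in $\mathrm{HH}^1(k(P\rtimes E))$ is represented by a derivation on $k(P\rtimes E)$ with image contained in the Jacobson radical $J(k(P\rtimes E))$. 2. If the $\mathbb{F}_pE$-module $P/\Phi(P)$ is multiplicity free, then the Lie algebra $\mathrm{HH}^1(k(P\rtimes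 E))$ is solvable. 3. Conversely, if $p$ is odd and the Lie algebra $\mathrm{HH}^1(k(P\rtimes E))$ is solvable, then the $\mathbb{F}_pE$-module $P/\Phi(P)$ is multiplicity free. -/

import Mathlib

/-! ### The Lie algebra `HH¹(A) = Der(A) / IDer(A)` -/

section HochschildOne

variable (k A : Type*) [CommRing k] [Ring A] [Algebra k A]

/-- The Lie ring `End_k(A)`, with the commutator bracket `[f, g] = f ∘ g - g ∘ f`. -/
abbrev endLieRing : LieRing (Module.End k A) := LieRing.ofAssociativeRing

attribute [local instance] endLieRing

/-- The Lie algebra `Der(A)` of `k`-linear derivations `A → A` of a not necessarily commutative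
`k`-algebra `A`, a Lie subalgebra of `End_k(A)` with the commutator bracket. -/
def DerAlg : LieSubalgebra k (Module.End k A) where
  carrier := {f | ∀ a b : A, f (a * b) = f a * b + a * f b}
  add_mem' := by
    intro f g hf hg a b
    change ∀ a b : A, f (a * b) = f a * b + a * f b at hf
    change ∀ a b : A, g (a * b) = g a * b + a * g b at hg
    rw [LinearMap.add_apply, LinearMap.add_apply, LinearMap.add_apply, hf, hg]
    noncomm_ring
  zero_mem' := by
    intro a b
    simp
  smul_mem' := by
    intro c f hf a b
    change ∀ a b : A, f (a * b) = f a * b + a * f b at hf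
    rw [LinearMap.smul_apply, LinearMap.smul_apply, LinearMap.smul_apply, hf, smul_add,
      smul_mul_assoc, mul_smul_comm]
  lie_mem' := by
    intro f g hf hg a b
    change ∀ a b : A, f (a * b) = f a * b + a * f b at hf
    change ∀ a b : A, g (a * b) = g a * b + a * g b at hg
    simp only [Ring.lie_def, LinearMap.sub_apply, Module.End.mul_apply, hf, hg, map_add]
    noncomm_ring

/-- The Lie ideal `IDer(A)` of `Der(A)` of inner derivations `a ↦ c a - a c`, with `c ∈ A`. -/
def IDerAlg : LieIdeal k (DerAlg k A) where
  carrier := {f | ∃ c : A, ∀ a : A, (f : Module.End k A) a = c * a - a * c}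
  add_mem' := by
    rintro f g ⟨c, hc⟩ ⟨d, hd⟩
    refine ⟨c + d, fun a => ?_⟩
    change (f : Module.End k A) a + (g : Module.End k A) a = _
    rw [hc, hd]
    noncomm_ring
  zero_mem' := ⟨0, fun a => by simp⟩
  smul_mem' := by
    rintro r f ⟨c, hc⟩
    refine ⟨r • c, fun a => ?_⟩
    change r • (f : Module.End k A) a = _
    rw [hc, smul_sub, smul_mul_assoc, mul_smul_comm]
  lie_mem := by
    rintro f g ⟨c, hc⟩
    refine ⟨(f : Module.End k A) c, fun a => ?_⟩
    have hf : ∀ a b : A, (f : Module.End k A) (a * b) =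
        (f : Module.End k A) a * b + a * (f : Module.End k A) b := f.2
    change (f : Module.End k A) ((g : Module.End k A) a) -
      (g : Module.End k A) ((f : Module.End k A) a) = _
    rw [hc, hc, map_sub, hf, hf]
    noncomm_ring

/-- The first Hochschild cohomology `HH¹(A)`, as the Lie algebra `Der(A) / IDer(A)`, that is,
Hochschild `1`-cocycles modulo `1`-coboundaries with the bracket induced by the commutator. -/
abbrev HHOne : Type _ := DerAlg k A ⧸ IDerAlg k A

end HochschildOne

/-! ### Multiplicity free modules -/

/-- A module is multiplicity free if it is the (internal) direct sum of a family of pairwise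
non-isomorphic simple submodules. -/
def IsMultiplicityFree (R M : Type*) [Ring R] [AddCommGroup M] [Module R M] : Prop :=
  ∃ 𝒮 : Set (Submodule R M), sSupIndep 𝒮 ∧ sSup 𝒮 = ⊤ ∧ (∀ S ∈ 𝒮, IsSimpleModule R S) ∧
    𝒮.Pairwise fun S T => IsEmpty (S ≃ₗ[R] T)

/-! ### Groups acting on abelian `p`-groups -/

section Action

variable {P E : Type*} [CommGroup P] [Group E]

/-- For `E` acting on `P` through `φ`, the subgroup `[P, E]` of `P` generated by the elements
`(ᵉu) u⁻¹` with `u ∈ P` and `e ∈ E`. -/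
def actionCommutator (φ : E →* MulAut P) : Subgroup P :=
  Subgroup.closure {x | ∃ (e : E) (u : P), x = φ e u * u⁻¹}

/-- In a finite abelian `p`-group the `p`-th powers lie in the Frattini subgroup. -/
theorem pow_mem_frattini [Finite P] {p : ℕ} [Fact p.Prime] (hP : IsPGroup p P) (x : P) :
    x ^ p ∈ frattini P := by
  by_contra hx
  have hM : ∃ M : Subgroup P, IsCoatom M ∧ x ^ p ∉ M := by
    by_contra h
    push Not at h
    apply hx
    simp only [frattini, Order.radical, Subgroup.mem_iInf]
    exact fun M hM => h M hM
  obtain ⟨M, hM, hxM⟩ := hM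
  let K : Subgroup P := (powMonoidHom p : P →* P).range
  have hK : M ⊔ K = ⊤ := by
    apply hM.2
    refine lt_of_le_of_ne le_sup_left fun h => hxM ?_
    rw [h]
    exact (le_sup_right : K ≤ M ⊔ K) ⟨x, rfl⟩
  have step : ∀ n : ℕ, ∀ y : P, ∃ z : P, ∃ m ∈ M, y = m * z ^ p ^ n := by
    intro n
    induction n with
    | zero => exact fun y => ⟨y, 1, M.one_mem, by simp⟩
    | succ n ih =>
      intro y
      obtain ⟨z, m, hm, rfl⟩ := ih y
      have hz : z ∈ M ⊔ K := hK ▸ Subgroup.mem_top z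
      obtain ⟨m', hm', w, ⟨v, rfl⟩, rfl⟩ := Subgroup.mem_sup.1 hz
      refine ⟨v, m * m' ^ p ^ n, M.mul_mem hm (M.pow_mem hm' _), ?_⟩
      simp only [powMonoidHom_apply]
      rw [mul_pow, ← pow_mul, mul_assoc, pow_succ, mul_comm (p ^ n) p]
  obtain ⟨n, hn⟩ := IsPGroup.iff_card.1 hP
  apply hM.1
  rw [eq_top_iff]
  intro y _
  obtain ⟨z, m, hm, rfl⟩ := step n y
  rw [← hn, pow_card_eq_one', mul_one]
  exact hm

/-- The `𝔽_p`-vector space structure on `P / Φ(P)`, written additively. -/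
abbrev frattiniQuotientModule [Finite P] {p : ℕ} [Fact p.Prime] (hP : IsPGroup p P) :
    Module (ZMod p) (Additive (P ⧸ frattini P)) :=
  AddCommGroup.zmodModule fun x => by
    induction x using Additive.rec with
    | ofMul y =>
      induction y using QuotientGroup.induction_on with
      | H y =>
        rw [← ofMul_pow, ← QuotientGroup.mk_pow, (QuotientGroup.eq_one_iff _).2
          (pow_mem_frattini hP y), ofMul_one]

/-- The action of `E` on `P / Φ(P)` induced by the action `φ` on `P`: `e` sends the class of `x`
to the class of `φ e x`. -/
def frattiniQuotientAction (φ : E →* MulAut P) : E →* Monoid.End (P ⧸ frattini P) where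
  toFun e := QuotientGroup.map (frattini P) (frattini P) (φ e).toMonoidHom
    (Subgroup.characteristic_iff_le_comap.1 inferInstance (φ e))
  map_one' := by
    ext x
    induction x using QuotientGroup.induction_on with
    | H x =>
      rw [map_one]
      rfl
  map_mul' e f := by
    ext x
    induction x using QuotientGroup.induction_on with
    | H x =>
      rw [map_mul]
      rfl

/-- The representation of `E` over `𝔽_p` on `P / Φ(P)`. -/
def frattiniQuotientRep [Finite P] {p : ℕ} [Fact p.Prime] (hP : IsPGroup p P)
    (φ : E →* MulAut P) :
    letI := frattiniQuotientModule hP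
    Representation (ZMod p) E (Additive (P ⧸ frattini P)) :=
  letI := frattiniQuotientModule hP
  { toFun := fun e => (MonoidHom.toAdditive (frattiniQuotientAction φ e)).toZModLinearMap p
    map_one' := by
      rw [map_one]
      rfl
    map_mul' := fun e f => by
      rw [map_mul]
      rfl }

/-- The `𝔽_p E`-module `P / Φ(P)` is multiplicity free. -/
def FrattiniQuotientMultiplicityFree [Finite P] {p : ℕ} [Fact p.Prime] (hP : IsPGroup p P)
    (φ : E →* MulAut P) : Prop :=
  letI := frattiniQuotientModule hP
  IsMultiplicityFree (MonoidAlgebra (ZMod p) E) (frattiniQuotientRep hP φ).asModule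

end Action

/-! Write A = k(P ⋊ E) as the direct sum of the kP·e with e ∈ E, and let I be the augmentation ideal
of kP, which is nilpotent. The sums of the Iⁿ·e filter A multiplicatively, and the first step lies
in J(A). The plan is to choose good representatives modulo inner derivations and to read them in
I/I², which is k ⊗ P/Φ(P).

Normal form. As |E| is invertible in k, averaging makes a derivation f vanish on E, so that f
commutes with conjugation by E. The coefficient at e of f(u)u⁻¹ is a 1-cocycle of P in kP, where u
acts as multiplication by u(ᵉu)⁻¹. If e acts non-trivially, coprimality makes it a coboundary modulo
I² (`exists_coboundary_modEq`). If e acts trivially, then e is central, and the augmentation of the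
coefficient of f(u) is an E-invariant homomorphism from P to k, which is zero because [P,E] = P
(`coef_mem_augIdeal_of_mem_ker`). This gives claim 1.

Solvability. If P/Φ(P) is multiplicity free it is cyclic, so a single v generates P under E. Modulo
the second step, a normalized f sends v - 1 to t(v - 1), with t in the span of conjugations by E
composed with right multiplications by C_E(P). Derivations vanishing on E commute with such t, and
these t commute with each other on kP because E/C_E(P) is abelian and C_E(P) is central. So a
bracket of normalized derivations falls one step deeper (`lie_mem_derFil_one`), and the derived
series then descends a filtration that ends at zero.

Converse. A repeated simple summand yields an sl₂-triple x, y, z of E-endomorphisms of P/Φ(P). They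
lift to derivations of A (`exists_isLift`), brackets lift brackets, and an inner lift induces zero.
For p odd, [z,x] = 2x and [z,y] = -2y keep non-zero multiples of the triple in every derived term.
-/

section

open MonoidAlgebra

/-! ### The group algebra of a semidirect product -/

section SemidirectAlgebra

variable (k : Type*) {P E : Type*} [Field k] [CommGroup P] [Group E] (φ : E →* MulAut P)

/-- The group algebra of `P ⋊ E`. -/
abbrev SemidirectAlgebra := MonoidAlgebra k (P ⋊[φ] E)

namespace SemidirectAlgebra

/-- The embedding of `kP`. -/
noncomputable def emb : MonoidAlgebra k P →ₐ[k] SemidirectAlgebra k φ :=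
  mapDomainAlgHom k k SemidirectProduct.inl

/-- The embedding of `E`. -/
noncomputable def grp : E →* SemidirectAlgebra k φ := (of k _).comp SemidirectProduct.inr

/-- The action of `E` on `kP`. -/
noncomputable def act (e : E) : MonoidAlgebra k P →ₐ[k] MonoidAlgebra k P :=
  mapDomainAlgHom k k (φ e).toMonoidHom

open Classical in
/-- The coefficient in `kP` of an element of `k(P ⋊ E)` at an element of `E`. -/
noncomputable def coef (e : E) : SemidirectAlgebra k φ →ₗ[k] MonoidAlgebra k P :=
  (MonoidAlgebra.basis (P ⋊[φ] E) k).constr k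
    fun g => if g.right = e then single g.left 1 else 0

open Classical in
theorem coef_single (e : E) (g : P ⋊[φ] E) (r : k) :
    coef k φ e (single g r) = if g.right = e then single g.left r else 0 := by
  have : single g r = r • (MonoidAlgebra.basis (P ⋊[φ] E) k) g := by
    rw [MonoidAlgebra.basis_apply, smul_single, smul_eq_mul, mul_one]
  rw [this, map_smul, coef, Module.Basis.constr_basis]
  split_ifs <;> simp

@[simp] theorem emb_single (u : P) (r : k) :
    emb k φ (single u r) = single (SemidirectProduct.inl u) r := by simp [emb]

theorem grp_apply (e : E) : grp k φ e = single (SemidirectProduct.inr e) 1 := by simp [grp]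

@[simp] theorem act_single (e : E) (u : P) (r : k) :
    act k φ e (single u r) = single (φ e u) r := by simp [act]

theorem act_one : act k φ 1 = AlgHom.id k _ := by
  ext; simp

theorem act_act (e f : E) (x : MonoidAlgebra k P) :
    act k φ e (act k φ f x) = act k φ (e * f) x := by
  induction x using induction_linear with
  | zero => simp
  | add x y hx hy => simp [hx, hy]
  | single u r => simp

theorem grp_mul_emb (e : E) (x : MonoidAlgebra k P) :
    grp k φ e * emb k φ x = emb k φ (act k φ e x) * grp k φ e := by
  induction x using induction_linear with
  | zero => simp
  | add x y hx hy => simp [hx, hy, mul_add, add_mul]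
  | single u r =>
    simp only [emb_single, grp_apply, act_single, single_mul_single, one_mul, mul_one]
    congr 1
    ext <;> simp

open Classical in
theorem coef_emb_mul_grp (e g : E) (x : MonoidAlgebra k P) :
    coef k φ e (emb k φ x * grp k φ g) = if g = e then x else 0 := by
  induction x using induction_linear with
  | zero => simp
  | add x y hx hy => rw [map_add, add_mul, map_add, hx, hy]; split_ifs <;> simp
  | single u r => simp [grp_apply, coef_single]

theorem coef_emb_mul_grp_self (e : E) (x : MonoidAlgebra k P) :
    coef k φ e (emb k φ x * grp k φ e) = x := by simp [coef_emb_mul_grp]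

theorem coef_emb_mul_grp_ne {e g : E} (h : g ≠ e) (x : MonoidAlgebra k P) :
    coef k φ e (emb k φ x * grp k φ g) = 0 := by simp [coef_emb_mul_grp, h]

theorem coef_one_emb (x : MonoidAlgebra k P) : coef k φ 1 (emb k φ x) = x := by
  simpa using coef_emb_mul_grp_self k φ 1 x

variable {k φ}

@[elab_as_elim]
theorem induction_emb_grp {motive : SemidirectAlgebra k φ → Prop} (a : SemidirectAlgebra k φ)
    (add : ∀ a b, motive a → motive b → motive (a + b))
    (emb_grp : ∀ x e, motive (emb k φ x * grp k φ e)) : motive a := by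
  induction a using induction_linear with
  | zero => simpa using emb_grp 0 1
  | add a b ha hb => exact add a b ha hb
  | single g r =>
    have := emb_grp (single g.left r) g.right
    simpa [grp_apply] using this

theorem eq_sum_coef [Fintype E] (a : SemidirectAlgebra k φ) :
    a = ∑ e, emb k φ (coef k φ e a) * grp k φ e := by
  induction a using induction_emb_grp with
  | add a b ha hb =>
    simp only [map_add, add_mul, Finset.sum_add_distrib]
    rw [← ha, ← hb]
  | emb_grp x e =>
    rw [Finset.sum_eq_single e]
    · rw [coef_emb_mul_grp_self]
    · intro g _ hg
      rw [coef_emb_mul_grp_ne k φ hg.symm]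
      simp
    · simp

theorem coef_ext [Finite E] {a b : SemidirectAlgebra k φ}
    (h : ∀ e, coef k φ e a = coef k φ e b) : a = b := by
  have := Fintype.ofFinite E
  rw [eq_sum_coef a, eq_sum_coef b]
  simp only [h]

theorem coef_emb_mul (e : E) (x : MonoidAlgebra k P) (a : SemidirectAlgebra k φ) :
    coef k φ e (emb k φ x * a) = x * coef k φ e a := by
  induction a using induction_emb_grp with
  | add a b ha hb => simp only [mul_add, map_add, ha, hb]
  | emb_grp y g =>
    rw [← mul_assoc, ← map_mul, coef_emb_mul_grp, coef_emb_mul_grp]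
    split_ifs <;> simp

theorem coef_mul_emb (e : E) (x : MonoidAlgebra k P) (a : SemidirectAlgebra k φ) :
    coef k φ e (a * emb k φ x) = coef k φ e a * act k φ e x := by
  induction a using induction_emb_grp with
  | add a b ha hb => simp only [add_mul, map_add, ha, hb]
  | emb_grp y g =>
    rw [mul_assoc, grp_mul_emb, ← mul_assoc, ← map_mul, coef_emb_mul_grp, coef_emb_mul_grp]
    split_ifs with h
    · rw [h]
    · simp

theorem coef_mul_grp (e g : E) (a : SemidirectAlgebra k φ) :
    coef k φ e (a * grp k φ g) = coef k φ (e * g⁻¹) a := by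
  induction a using induction_emb_grp with
  | add a b ha hb => simp only [add_mul, map_add, ha, hb]
  | emb_grp y f =>
    rw [mul_assoc, ← map_mul, coef_emb_mul_grp, coef_emb_mul_grp]
    classical
    exact if_congr eq_mul_inv_iff_mul_eq.symm rfl rfl

theorem coef_grp_mul (e g : E) (a : SemidirectAlgebra k φ) :
    coef k φ e (grp k φ g * a) = act k φ g (coef k φ (g⁻¹ * e) a) := by
  induction a using induction_emb_grp with
  | add a b ha hb => simp only [mul_add, map_add, ha, hb]
  | emb_grp y f =>
    rw [← mul_assoc, grp_mul_emb, mul_assoc, ← map_mul, coef_emb_mul_grp, coef_emb_mul_grp]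
    by_cases h : g * f = e
    · rw [if_pos h, if_pos (eq_inv_mul_iff_mul_eq.2 h)]
    · rw [if_neg h, if_neg (mt eq_inv_mul_iff_mul_eq.1 h), map_zero]

end SemidirectAlgebra

end SemidirectAlgebra

/-! ### The augmentation ideal -/

section Augmentation

variable (k P : Type*) [Field k] [CommGroup P]

/-- The augmentation ideal of `kP`. -/
noncomputable def augIdeal : Ideal (MonoidAlgebra k P) :=
  RingHom.ker (MonoidAlgebra.lift k k P 1)

variable {k P}

theorem mem_augIdeal {x : MonoidAlgebra k P} :
    x ∈ augIdeal k P ↔ MonoidAlgebra.lift k k P 1 x = 0 := Iff.rfl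

theorem single_sub_one_mem_augIdeal (u : P) : single u 1 - 1 ∈ augIdeal k P := by
  rw [mem_augIdeal]; simp

theorem sub_aug_mem (S : Submodule k (MonoidAlgebra k P))
    (hS : ∀ u : P, single u 1 - 1 ∈ S) (x : MonoidAlgebra k P) :
    x - algebraMap k _ (MonoidAlgebra.lift k k P 1 x) ∈ S := by
  induction x using induction_linear with
  | zero => simp
  | add x y hx hy =>
    have := S.add_mem hx hy
    rw [map_add, map_add]
    convert this using 1
    abel
  | single u r =>
    have := S.smul_mem r (hS u)
    convert this using 1
    rw [smul_sub, smul_single, smul_eq_mul, mul_one, MonoidAlgebra.lift_single,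
      MonoidHom.one_apply, smul_eq_mul, mul_one, Algebra.algebraMap_eq_smul_one]

/-- The elements u - 1 span the augmentation ideal over k, so linear statements need only be checked
on them. -/
theorem augIdeal_le (S : Submodule k (MonoidAlgebra k P))
    (hS : ∀ u : P, single u 1 - 1 ∈ S) {x : MonoidAlgebra k P} (hx : x ∈ augIdeal k P) :
    x ∈ S := by
  have := sub_aug_mem S hS x
  rwa [mem_augIdeal.1 hx, map_zero, sub_zero] at this

/-- The difference is (u - 1)(v - 1). Hence u ↦ u - 1 is a homomorphism from P to I/I². -/
theorem single_mul_sub_one_modEq (u v : P) :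
    (single (u * v) 1 - 1) - ((single u 1 - 1) + (single v 1 - 1)) ∈ augIdeal k P ^ 2 := by
  have : (single (u * v) 1 - 1 : MonoidAlgebra k P) - ((single u 1 - 1) + (single v 1 - 1)) =
      (single u 1 - 1) * (single v 1 - 1) := by
    rw [show (single (u * v) 1 : MonoidAlgebra k P) = single u 1 * single v 1 by simp]
    ring
  rw [this, pow_two]
  exact Ideal.mul_mem_mul (single_sub_one_mem_augIdeal u) (single_sub_one_mem_augIdeal v)

/-- The subgroup of the `u ∈ P` with `u - 1` in a subspace containing the square of the
augmentation ideal. -/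
def unipotentSubgroup (S : Submodule k (MonoidAlgebra k P))
    (hS : ∀ x ∈ augIdeal k P ^ 2, x ∈ S) : Subgroup P where
  carrier := {u | single u 1 - 1 ∈ S}
  one_mem' := by simp [one_def]
  mul_mem' := by
    intro u v hu hv
    have := S.add_mem (hS _ (single_mul_sub_one_modEq u v)) (S.add_mem hu hv)
    simpa using this
  inv_mem' := by
    intro u hu
    have := S.sub_mem (S.neg_mem hu) (hS _ (single_mul_sub_one_modEq u u⁻¹))
    rw [mul_inv_cancel, ← one_def, sub_self, zero_sub, sub_neg_eq_add, neg_add_cancel_left] at this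
    exact this

variable {p : ℕ} [Fact p.Prime] [CharP k p]

/-- In characteristic p, (u - 1)^(pⁿ) = u^(pⁿ) - 1, so the generators are nilpotent; kP is
Noetherian, so its nilradical is nilpotent. -/
theorem augIdeal_isNilpotent [Finite P] (hP : IsPGroup p P) : ∃ n, augIdeal k P ^ n = ⊥ := by
  have hle : augIdeal k P ≤ nilradical (MonoidAlgebra k P) := by
    intro x hx
    refine augIdeal_le ((nilradical (MonoidAlgebra k P)).restrictScalars k) (fun u => ?_) hx
    obtain ⟨n, hn⟩ := hP u
    have : CharP (MonoidAlgebra k P) p := charP_of_injective_algebraMap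
      (FaithfulSMul.algebraMap_injective k (MonoidAlgebra k P)) p
    refine ⟨p ^ n, ?_⟩
    rw [sub_pow_char_pow, single_pow, hn, one_pow, one_pow, ← one_def, sub_self]
    exact zero_mem _
  have hN : IsNoetherianRing (MonoidAlgebra k P) := by
    have : Module.Finite k (MonoidAlgebra k P) := .of_basis (MonoidAlgebra.basis P k)
    exact isNoetherian_of_tower k inferInstance
  obtain ⟨n, hn⟩ := IsNoetherianRing.isNilpotent_nilradical (MonoidAlgebra k P)
  exact ⟨n, le_bot_iff.1 ((Ideal.pow_right_mono hle n).trans hn.le)⟩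

theorem act_mem_augIdeal_pow {E : Type*} [Group E] (φ : E →* MulAut P) (e : E) (n : ℕ)
    {x : MonoidAlgebra k P} (hx : x ∈ augIdeal k P ^ n) :
    SemidirectAlgebra.act k φ e x ∈ augIdeal k P ^ n := by
  have h1 : (augIdeal k P).map (SemidirectAlgebra.act k φ e) ≤ augIdeal k P := by
    rw [Ideal.map_le_iff_le_comap]
    intro y hy
    exact augIdeal_le (Submodule.comap (SemidirectAlgebra.act k φ e).toLinearMap
      ((augIdeal k P).restrictScalars k))
      (fun u => by simpa [one_def] using single_sub_one_mem_augIdeal (k := k) (φ e u)) hy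
  have h2 := Ideal.mem_map_of_mem (SemidirectAlgebra.act k φ e) hx
  rw [Ideal.map_pow] at h2
  exact Ideal.pow_right_mono h1 n h2

end Augmentation

/-! ### Derivations of a noncommutative algebra -/

section Derivations

variable {k A : Type*} [CommRing k] [Ring A] [Algebra k A]

theorem DerAlg.leibniz (f : DerAlg k A) (a b : A) : f.1 (a * b) = f.1 a * b + a * f.1 b :=
  f.2 a b

theorem DerAlg.map_one (f : DerAlg k A) : f.1 1 = 0 := by
  have := DerAlg.leibniz f 1 1
  simpa using this

theorem DerAlg.lie_apply (f g : DerAlg k A) (a : A) :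
    (⁅f, g⁆ : DerAlg k A).1 a = f.1 (g.1 a) - g.1 (f.1 a) := rfl

theorem DerAlg.sub_apply (f g : DerAlg k A) (a : A) : (f - g).1 a = f.1 a - g.1 a := rfl

theorem DerAlg.add_apply (f g : DerAlg k A) (a : A) : (f + g).1 a = f.1 a + g.1 a := rfl

theorem DerAlg.smul_apply (r : k) (f : DerAlg k A) (a : A) : (r • f).1 a = r • f.1 a := rfl

variable (k) in
/-- The inner derivation defined by an element. -/
def innerDer (c : A) : DerAlg k A :=
  ⟨LinearMap.mulLeft k c - LinearMap.mulRight k c, fun a b => by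
    simp only [LinearMap.sub_apply, LinearMap.mulLeft_apply, LinearMap.mulRight_apply]
    noncomm_ring⟩

theorem innerDer_apply (c a : A) : (innerDer k c).1 a = c * a - a * c := rfl

theorem HHOne.mk_sub_innerDer (f : DerAlg k A) (c : A) :
    (LieSubmodule.Quotient.mk (f - innerDer k c) : HHOne k A) = LieSubmodule.Quotient.mk f := by
  refine (Submodule.Quotient.eq _).2 ?_
  rw [sub_sub_cancel_left]
  exact neg_mem (show innerDer k c ∈ IDerAlg k A from ⟨c, fun a => rfl⟩)

end Derivations

namespace SemidirectAlgebra

variable {k P E : Type*} [Field k] [CommGroup P] [Group E] {φ : E →* MulAut P}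

/-! ### The radical filtration -/

variable (k φ) in
/-- The elements of `k(P ⋊ E)` whose coefficients are in the `n`-th power of the augmentation
ideal of `kP`. -/
noncomputable def fil (n : ℕ) : Submodule k (SemidirectAlgebra k φ) :=
  ⨅ e, ((augIdeal k P ^ n).restrictScalars k).comap (coef k φ e)

theorem mem_fil {n : ℕ} {a : SemidirectAlgebra k φ} :
    a ∈ fil k φ n ↔ ∀ e, coef k φ e a ∈ augIdeal k P ^ n := by
  simp [fil]

theorem mem_fil_zero (a : SemidirectAlgebra k φ) : a ∈ fil k φ 0 := by
  simp [mem_fil]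

theorem fil_antitone : Antitone (fil k φ) := fun _ _ h _ ha =>
  mem_fil.2 fun e => Ideal.pow_le_pow_right h (mem_fil.1 ha e)

theorem emb_mul_grp_mem_fil {n : ℕ} {x : MonoidAlgebra k P} (hx : x ∈ augIdeal k P ^ n) (e : E) :
    emb k φ x * grp k φ e ∈ fil k φ n := by
  classical
  refine mem_fil.2 fun g => ?_
  rw [coef_emb_mul_grp]
  split_ifs
  exacts [hx, zero_mem _]

theorem emb_mem_fil {n : ℕ} {x : MonoidAlgebra k P} (hx : x ∈ augIdeal k P ^ n) :
    emb k φ x ∈ fil k φ n := by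
  simpa using emb_mul_grp_mem_fil hx (1 : E)

theorem emb_mem_fil_iff {n : ℕ} {x : MonoidAlgebra k P} :
    emb k φ x ∈ fil k φ n ↔ x ∈ augIdeal k P ^ n :=
  ⟨fun h => by simpa [coef_one_emb] using mem_fil.1 h 1, emb_mem_fil⟩

/-! ### Derivations vanishing on `E` -/

variable (k φ) in
/-- The derivations vanishing on `E` with values on `P` in the `(m + 1)`-st step of the
filtration. -/
noncomputable def derFil (m : ℕ) : Submodule k (DerAlg k (SemidirectAlgebra k φ)) where
  carrier := {f | (∀ e, f.1 (grp k φ e) = 0) ∧ ∀ u : P, f.1 (emb k φ (single u 1)) ∈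
    fil k φ (m + 1)}
  add_mem' {f g} hf hg := ⟨fun e => by rw [DerAlg.add_apply, hf.1, hg.1, add_zero],
    fun u => add_mem (hf.2 u) (hg.2 u)⟩
  zero_mem' := ⟨fun e => rfl, fun u => zero_mem _⟩
  smul_mem' r f hf := ⟨fun e => by rw [DerAlg.smul_apply, hf.1, smul_zero],
    fun u => Submodule.smul_mem _ r (hf.2 u)⟩

theorem der_mul_grp {f : DerAlg k (SemidirectAlgebra k φ)}
    (hf : ∀ e, f.1 (grp k φ e) = 0) (a : SemidirectAlgebra k φ) (e : E) :
    f.1 (a * grp k φ e) = f.1 a * grp k φ e := by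
  rw [DerAlg.leibniz f, hf, mul_zero, add_zero]

theorem der_grp_mul {f : DerAlg k (SemidirectAlgebra k φ)}
    (hf : ∀ e, f.1 (grp k φ e) = 0) (a : SemidirectAlgebra k φ) (e : E) :
    f.1 (grp k φ e * a) = grp k φ e * f.1 a := by
  rw [DerAlg.leibniz f, hf, zero_mul, zero_add]

theorem derFil_antitone : Antitone (derFil k φ) := fun _ _ h _ hf =>
  ⟨hf.1, fun u => fil_antitone (Nat.succ_le_succ h) (hf.2 u)⟩

theorem der_emb_mem_fil {m : ℕ} {f : DerAlg k (SemidirectAlgebra k φ)} (hf : f ∈ derFil k φ m)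
    (x : MonoidAlgebra k P) : f.1 (emb k φ x) ∈ fil k φ (m + 1) := by
  induction x using induction_linear with
  | zero => simp
  | add x y hx hy => rw [map_add, map_add]; exact add_mem hx hy
  | single u r =>
    have : (single u r : MonoidAlgebra k P) = r • single u 1 := by simp
    rw [this, map_smul, map_smul]
    exact Submodule.smul_mem _ r (hf.2 u)

variable [Finite E]

theorem mul_mem_fil {m n : ℕ} {a b : SemidirectAlgebra k φ} (ha : a ∈ fil k φ m)
    (hb : b ∈ fil k φ n) : a * b ∈ fil k φ (m + n) := by
  have := Fintype.ofFinite E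
  rw [eq_sum_coef a, eq_sum_coef b, Finset.sum_mul_sum]
  refine Submodule.sum_mem _ fun e _ => Submodule.sum_mem _ fun g _ => ?_
  have : emb k φ (coef k φ e a) * grp k φ e * (emb k φ (coef k φ g b) * grp k φ g) =
      emb k φ (coef k φ e a * act k φ e (coef k φ g b)) * grp k φ (e * g) := by
    rw [map_mul, map_mul, mul_assoc, ← mul_assoc (grp k φ e), grp_mul_emb]
    noncomm_ring
  rw [this]
  refine emb_mul_grp_mem_fil ?_ _
  rw [pow_add]
  exact Ideal.mul_mem_mul (mem_fil.1 ha e) (act_mem_augIdeal_pow φ e n (mem_fil.1 hb g))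

theorem mul_mem_fil_left {n : ℕ} {a : SemidirectAlgebra k φ} (ha : a ∈ fil k φ n)
    (b : SemidirectAlgebra k φ) : a * b ∈ fil k φ n := by
  simpa using mul_mem_fil ha (mem_fil_zero b)

theorem mul_mem_fil_right {n : ℕ} {a : SemidirectAlgebra k φ} (ha : a ∈ fil k φ n)
    (b : SemidirectAlgebra k φ) : b * a ∈ fil k φ n := by
  simpa using mul_mem_fil (mem_fil_zero b) ha

theorem fil_induction {n : ℕ} {S : Submodule k (SemidirectAlgebra k φ)}
    (h : ∀ x ∈ augIdeal k P ^ n, ∀ e, emb k φ x * grp k φ e ∈ S)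
    {a : SemidirectAlgebra k φ} (ha : a ∈ fil k φ n) : a ∈ S := by
  have := Fintype.ofFinite E
  rw [eq_sum_coef a]
  exact Submodule.sum_mem _ fun e _ => h _ (mem_fil.1 ha e) e

theorem pow_mem_fil {a : SemidirectAlgebra k φ} (ha : a ∈ fil k φ 1) (n : ℕ) :
    a ^ n ∈ fil k φ n := by
  induction n with
  | zero => exact mem_fil_zero _
  | succ n ih => rw [pow_succ]; exact mul_mem_fil ih ha

theorem exists_fil_eq_bot {p : ℕ} [Fact p.Prime] [CharP k p] [Finite P] (hP : IsPGroup p P) :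
    ∃ n, fil k φ n = ⊥ := by
  obtain ⟨n, hn⟩ := augIdeal_isNilpotent (k := k) hP
  refine ⟨n, (Submodule.eq_bot_iff _).2 fun a ha => coef_ext fun e => ?_⟩
  simpa [hn] using mem_fil.1 ha e

theorem fil_one_le_jacobson {p : ℕ} [Fact p.Prime] [CharP k p] [Finite P] (hP : IsPGroup p P)
    {a : SemidirectAlgebra k φ} (ha : a ∈ fil k φ 1) :
    a ∈ Ring.jacobson (SemidirectAlgebra k φ) := by
  obtain ⟨n, hn⟩ := exists_fil_eq_bot (k := k) (φ := φ) hP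
  rw [← Ideal.jacobson_bot, Ideal.mem_jacobson_iff]
  intro y
  have hnil : IsNilpotent (y * a) := ⟨n, by
    simpa [hn] using pow_mem_fil (mul_mem_fil_right ha y) n⟩
  obtain ⟨v, hv⟩ := hnil.isUnit_one_add
  refine ⟨(v⁻¹ : (SemidirectAlgebra k φ)ˣ), ?_⟩
  have : (v⁻¹ : (SemidirectAlgebra k φ)ˣ) * (1 + y * a) = 1 := by rw [← hv, Units.inv_mul]
  rw [Ideal.mem_bot, ← this]
  noncomm_ring

/-- The Leibniz rule replaces one factor in I by a factor in step m + 1, so the degree rises by m.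
This is why level m is defined by values in step m + 1. -/
theorem der_mem_fil {m n : ℕ} {f : DerAlg k (SemidirectAlgebra k φ)} (hf : f ∈ derFil k φ m)
    {a : SemidirectAlgebra k φ} (ha : a ∈ fil k φ n) : f.1 a ∈ fil k φ (n + m) := by
  have key : ∀ x ∈ augIdeal k P ^ n, f.1 (emb k φ x) ∈ fil k φ (n + m) := by
    clear ha
    induction n with
    | zero =>
      intro x _
      rw [zero_add]
      exact fil_antitone (Nat.le_succ m) (der_emb_mem_fil hf x)
    | succ n ih =>
      intro x hx
      rw [pow_succ] at hx
      induction hx using Submodule.mul_induction_on' with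
      | mem_mul_mem x hx y hy =>
        rw [map_mul, DerAlg.leibniz f]
        refine add_mem ?_ ?_
        · have := mul_mem_fil (ih x hx) (emb_mem_fil (φ := φ) (n := 1) (by simpa using hy))
          rwa [add_right_comm] at this
        · have := mul_mem_fil (emb_mem_fil (φ := φ) hx) (der_emb_mem_fil hf y)
          rwa [← add_assoc, add_right_comm] at this
      | add x _ y _ hx hy => rw [map_add, map_add]; exact add_mem hx hy
  refine fil_induction (S := (fil k φ (n + m)).comap f.1) (fun x hx e => ?_) ha
  rw [Submodule.mem_comap, der_mul_grp hf.1]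
  exact mul_mem_fil_left (key x hx) _

theorem lie_mem_derFil {m n : ℕ} {f g : DerAlg k (SemidirectAlgebra k φ)}
    (hf : f ∈ derFil k φ m) (hg : g ∈ derFil k φ n) : ⁅f, g⁆ ∈ derFil k φ (m + n) := by
  refine ⟨fun e => ?_, fun u => ?_⟩
  · rw [DerAlg.lie_apply, hf.1, hg.1, map_zero, map_zero, sub_zero]
  · rw [DerAlg.lie_apply]
    refine sub_mem ?_ ?_
    · have := der_mem_fil hf (hg.2 u)
      rwa [show n + 1 + m = m + n + 1 by ring] at this
    · have := der_mem_fil hg (hf.2 u)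
      rwa [show m + 1 + n = m + n + 1 by ring] at this

theorem eq_zero_of_mem_derFil {m : ℕ} (hm : fil k φ m = ⊥)
    {f : DerAlg k (SemidirectAlgebra k φ)} (hf : f ∈ derFil k φ m) : f = 0 := by
  refine Subtype.ext (LinearMap.ext fun a => ?_)
  have := fil_antitone (Nat.le_add_left m 0) (der_mem_fil hf (mem_fil_zero a))
  simpa [hm] using this

end SemidirectAlgebra

/-! ### Cocycles of an abelian `p`-group twisted by an automorphism of order prime to `p` -/

section Twisted

variable {P : Type*} [CommGroup P]

/-- The endomorphism `u ↦ u (σ u)⁻¹`. -/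
def twist (σ : MulAut P) : P →* P := MonoidHom.id P / σ.toMonoidHom

theorem twist_apply (σ : MulAut P) (u : P) : twist σ u = u / σ u := rfl

/-- If x = y(σy)⁻¹ is fixed by σ, then σⁿy = x⁻ⁿy, so xʳ = 1 with r prime to p while x has p-power
order. Thus the kernel and the image of the twist meet trivially. -/
theorem twist_twist_eq_one {p : ℕ} [Fact p.Prime] (hP : IsPGroup p P) {σ : MulAut P} {r : ℕ}
    (hr : ¬ p ∣ r) (hσ : σ ^ r = 1) {y : P} (h : twist σ (twist σ y) = 1) : twist σ y = 1 := by
  set x := twist σ y with hx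
  have hfix : σ x = x := by rw [twist_apply, div_eq_one] at h; exact h.symm
  have hy : σ y = x⁻¹ * y := by rw [hx, twist_apply, inv_div, div_mul_cancel]
  have hn : ∀ n : ℕ, (σ ^ n) y = x⁻¹ ^ n * y := by
    intro n
    induction n with
    | zero => simp
    | succ n ih =>
      rw [pow_succ', MulAut.mul_apply, ih, map_mul, map_pow, map_inv, hfix, hy, pow_succ, mul_assoc]
  have h1 : x⁻¹ ^ r = 1 := by
    have := hn r
    rw [hσ, MulAut.one_apply] at this
    exact (mul_eq_right.1 this.symm)
  rw [inv_pow, inv_eq_one] at h1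
  obtain ⟨n, hn⟩ := hP x
  have hco : Nat.Coprime (p ^ n) r := ((Nat.Prime.coprime_iff_not_dvd Fact.out).2 hr).pow_left n
  exact orderOf_eq_one_iff.1 (Nat.eq_one_of_dvd_coprimes hco (orderOf_dvd_of_pow_eq_one hn)
    (orderOf_dvd_of_pow_eq_one h1))

theorem twist_map (σ : MulAut P) (u : P) : twist σ (σ u) = σ (twist σ u) := by
  simp [twist_apply]

variable (k : Type*) [Field k]

open Classical in
/-- The projection of `kP` onto the span of a transversal of a subgroup. -/
noncomputable def transversalProj (Q : Subgroup P) : MonoidAlgebra k P →ₗ[k] MonoidAlgebra k P :=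
  (MonoidAlgebra.basis P k).constr k
    fun u => if (Quotient.out (u : P ⧸ Q) : P) = u then single u 1 else 0

/-- The translates by Q of the span of a transversal decompose kP, and each summand is the
projection onto one translate. This is the freeness of kP over kQ in usable form. -/
theorem sum_transversalProj (Q : Subgroup P) [Fintype Q] (x : MonoidAlgebra k P) :
    ∑ q : Q, single (q : P) 1 * transversalProj k Q (single (q : P)⁻¹ 1 * x) = x := by
  classical
  have hlin : (∑ q : Q, LinearMap.mulLeft k (single (q : P) 1) ∘ₗ transversalProj k Q ∘ₗ
      LinearMap.mulLeft k (single (q : P)⁻¹ 1)) = LinearMap.id := by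
    refine (MonoidAlgebra.basis P k).ext fun u => ?_
    simp only [LinearMap.sum_apply, LinearMap.comp_apply, LinearMap.mulLeft_apply,
      LinearMap.id_apply, MonoidAlgebra.basis_apply, single_mul_single, mul_one]
    have hq : u * (Quotient.out (u : P ⧸ Q) : P)⁻¹ ∈ Q := by
      rw [mul_comm, ← QuotientGroup.eq]
      exact Quotient.out_eq (u : P ⧸ Q)
    have hcoe : ∀ q : Q, (((q : P)⁻¹ * u : P) : P ⧸ Q) = (u : P ⧸ Q) := fun q => by
      rw [QuotientGroup.eq]
      have : ((q : P)⁻¹ * u)⁻¹ * u = q := by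
        rw [mul_inv_rev, inv_inv, mul_right_comm, inv_mul_cancel, one_mul]
      rw [this]
      exact q.2
    have hval : ∀ q : Q, transversalProj k Q (single ((q : P)⁻¹ * u) 1) =
        if (Quotient.out (u : P ⧸ Q) : P) = (q : P)⁻¹ * u then single ((q : P)⁻¹ * u) 1 else 0 := by
      intro q
      rw [← MonoidAlgebra.basis_apply, transversalProj, Module.Basis.constr_basis, hcoe,
        MonoidAlgebra.basis_apply]
    rw [Finset.sum_eq_single (⟨_, hq⟩ : Q)]
    · rw [hval, if_pos]
      · simp
      · simp
    · intro q _ hne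
      rw [hval, if_neg, mul_zero]
      intro heq
      apply hne
      ext
      change (q : P) = u * (Quotient.out (u : P ⧸ Q) : P)⁻¹
      rw [heq]
      simp
    · simp
  have := LinearMap.congr_fun hlin x
  simpa using this

theorem eq_mul_of_invariant (Q : Subgroup P) [Fintype Q] {x : MonoidAlgebra k P}
    (hx : ∀ q ∈ Q, single q 1 * x = x) :
    x = (∑ q : Q, single (q : P) 1) * transversalProj k Q x := by
  conv_lhs => rw [← sum_transversalProj k Q x]
  rw [Finset.sum_mul]
  refine Finset.sum_congr rfl fun q _ => ?_
  rw [hx _ (Q.inv_mem q.2)]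

theorem sum_single_sub_one_modEq {ι : Type*} (s : Finset ι) (u : ι → P) :
    (∑ i ∈ s, (single (u i) 1 - 1)) - (single (∏ i ∈ s, u i) 1 - 1) ∈ augIdeal k P ^ 2 := by
  classical
  induction s using Finset.induction_on with
  | empty => simp [one_def]
  | insert i s hi ih =>
    rw [Finset.sum_insert hi, Finset.prod_insert hi]
    have := Ideal.sub_mem _ ih (single_mul_sub_one_modEq (k := k) (u i) (∏ i ∈ s, u i))
    convert this using 1
    ring

/-- The automorphism σ permutes the image of the twist, so the product is a σ-fixed element of that
image. -/
theorem prod_range_twist {p : ℕ} [Fact p.Prime] (hP : IsPGroup p P) {σ : MulAut P} {r : ℕ}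
    (hr : ¬ p ∣ r) (hσ : σ ^ r = 1) [Fintype (twist σ).range] :
    ∏ q : (twist σ).range, (q : P) = 1 := by
  set x := ∏ q : (twist σ).range, (q : P) with hx
  have hmem : ∀ q : (twist σ).range, σ q ∈ (twist σ).range := by
    rintro ⟨_, u, rfl⟩
    exact ⟨σ u, twist_map σ u⟩
  have hinj : Function.Injective fun q : (twist σ).range => (⟨σ q, hmem q⟩ : (twist σ).range) :=
    fun q q' h => Subtype.ext (σ.injective (congrArg Subtype.val h))
  have hfix : σ x = x := by
    rw [hx, map_prod]
    exact Function.Bijective.prod_comp (Finite.injective_iff_bijective.1 hinj)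
      (fun q : (twist σ).range => (q : P))
  obtain ⟨y, hy⟩ : x ∈ (twist σ).range := Subgroup.prod_mem _ fun q _ => q.2
  rw [← hy]
  refine twist_twist_eq_one hP hr hσ ?_
  rw [hy, twist_apply, hfix, div_self']

/-- Modulo I², the sum over Q is |Q| + (∏ q - 1). The product is 1, and p divides |Q| because Q is
non-trivial when σ ≠ 1. -/
theorem sum_range_twist_mem {p : ℕ} [Fact p.Prime] [CharP k p] [Finite P] (hP : IsPGroup p P)
    {σ : MulAut P} {r : ℕ} (hr : ¬ p ∣ r) (hσ : σ ^ r = 1) (hne : σ ≠ 1)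
    [Fintype (twist σ).range] :
    ∑ q : (twist σ).range, single (q : P) (1 : k) ∈ augIdeal k P ^ 2 := by
  have h := sum_single_sub_one_modEq k Finset.univ fun q : (twist σ).range => (q : P)
  rw [prod_range_twist hP hr hσ, ← one_def, sub_self, sub_zero, Finset.sum_sub_distrib] at h
  have hcard : ∑ q : (twist σ).range, (1 : MonoidAlgebra k P) = 0 := by
    rw [Finset.sum_const, nsmul_one, Finset.card_univ, ← Nat.card_eq_fintype_card]
    have hnt : Nontrivial (twist σ).range := by
      rw [Subgroup.nontrivial_iff_ne_bot]
      intro hbot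
      refine hne (MulEquiv.ext fun u => ?_)
      have : twist σ u ∈ (twist σ).range := ⟨u, rfl⟩
      rw [hbot, Subgroup.mem_bot, twist_apply, div_eq_one] at this
      exact this.symm
    obtain ⟨n, hn, hcard⟩ := (hP.to_subgroup (twist σ).range).nontrivial_iff_card.1 hnt
    have : CharP (MonoidAlgebra k P) p := charP_of_injective_algebraMap
      (FaithfulSMul.algebraMap_injective k (MonoidAlgebra k P)) p
    rw [hcard, CharP.cast_eq_zero_iff (MonoidAlgebra k P) p]
    exact dvd_pow_self p hn.ne'
  rwa [hcard, sub_zero] at h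

variable {k}

/-- The twist is bijective on its image Q and kP is free over kQ, so d restricted to Q is a
coboundary. After subtracting it, the values are Q-invariant, hence multiples of the sum of Q, which
lies in I². -/
theorem exists_coboundary_modEq {p : ℕ} [Fact p.Prime] [CharP k p] [Finite P] (hP : IsPGroup p P)
    {σ : MulAut P} {r : ℕ} (hr : ¬ p ∣ r) (hσ : σ ^ r = 1) (hne : σ ≠ 1)
    (d : P → MonoidAlgebra k P) (hd : ∀ u v, d (u * v) = d u + single (twist σ u) 1 * d v) :
    ∃ c, ∀ u, d u - (c - single (twist σ u) 1 * c) ∈ augIdeal k P ^ 2 := by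
  classical
  have := Fintype.ofFinite (twist σ).range
  set Q := (twist σ).range with hQ
  have hmem : ∀ u, twist σ u ∈ Q := fun u => ⟨u, rfl⟩
  let ψ : Q → Q := fun q => ⟨twist σ q, hmem q⟩
  have hψ : Function.Bijective ψ := by
    refine Finite.injective_iff_bijective.1 fun q q' h => ?_
    obtain ⟨y, hy⟩ := (q / q').2
    have h1 : twist σ (q / q' : Q) = 1 := by
      rw [Subgroup.coe_div, map_div, div_eq_one]
      exact congrArg Subtype.val h
    rw [← hy] at h1
    have := twist_twist_eq_one hP hr hσ h1
    rw [hy] at this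
    exact div_eq_one.1 (Subtype.ext this)
  -- The projections onto the translates of the transversal, indexed through the bijection ψ. They
  -- sum to the identity, which makes c below a contracting choice for d on Q.
  let F : Q → MonoidAlgebra k P → MonoidAlgebra k P := fun u x =>
    single (twist σ u) 1 * transversalProj k Q (single (twist σ u)⁻¹ 1 * x)
  have hF : ∀ x, ∑ u : Q, F u x = x := fun x =>
    (hψ.sum_comp fun q : Q => single (q : P) 1 *
      transversalProj k Q (single (q : P)⁻¹ 1 * x)).trans (sum_transversalProj k Q x)
  let c := ∑ u : Q, F u (d u)
  have hc : ∀ v : Q, single (twist σ v) 1 * c = c - d v := by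
    intro v
    have h1 : ∀ u : Q, single (twist σ v) 1 * F u (d u) = F (v * u) (d (v * u)) - F (v * u) (d v) := by
      intro u
      have h2 : single (twist σ u)⁻¹ 1 * d u =
          single (twist σ (v * u))⁻¹ 1 * (d (v * u) - d v) := by
        rw [hd, add_sub_cancel_left, ← mul_assoc, single_mul_single, map_mul, mul_one]
        congr 2
        simp
      simp only [F, Subgroup.coe_mul]
      rw [h2, ← mul_assoc, single_mul_single, ← map_mul, mul_one, mul_sub, map_sub, mul_sub]
    have h3 : ∑ u : Q, F (v * u) (d (v * u)) = c :=
      (Group.mulLeft_bijective v).sum_comp fun u : Q => F u (d u)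
    have h4 : ∑ u : Q, F (v * u) (d v) = d v :=
      ((Group.mulLeft_bijective v).sum_comp fun u : Q => F u (d v)).trans (hF _)
    rw [Finset.mul_sum, Finset.sum_congr rfl fun u _ => h1 u, Finset.sum_sub_distrib, h3, h4]
  refine ⟨c, fun u => ?_⟩
  set y := d u - (c - single (twist σ u) 1 * c) with hy
  have hinv : ∀ q ∈ Q, single q 1 * y = y := by
    intro q hq
    obtain ⟨v, hv⟩ := hψ.2 ⟨q, hq⟩
    have hvq : twist σ v = q := congrArg Subtype.val hv
    -- As P is abelian, d(uv) = d(vu) has two expansions; this forces the Q-invariance of the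
    -- remainder.
    have h5 : d u + single (twist σ u) 1 * d v = d v + single q 1 * d u := by
      rw [← hd, mul_comm u, hd, hvq]
    have h6 := hc v
    rw [hvq] at h6
    have h7 : d v = c - single q 1 * c := by rw [h6]; ring
    rw [h7] at h5
    rw [hy]
    linear_combination -h5
  rw [eq_mul_of_invariant k Q hinv]
  exact Ideal.mul_mem_right _ _ (sum_range_twist_mem k hP hr hσ hne)

end Twisted

/-! ### Normal forms of derivations -/

theorem inv_card_smul_sum_const {k ι M : Type*} [Field k] [Fintype ι] (hι : (Fintype.card ι : k) ≠ 0)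
    [AddCommGroup M] [Module k M] (m : M) : (Fintype.card ι : k)⁻¹ • ∑ _i : ι, m = m := by
  rw [Finset.sum_const, Finset.card_univ, ← Nat.cast_smul_eq_nsmul k, smul_smul,
    inv_mul_cancel₀ hι, one_smul]

namespace SemidirectAlgebra

variable {k P E : Type*} [Field k] [CommGroup P] [Group E] {φ : E →* MulAut P}

variable (k φ) in
/-- Conjugation by an element of `E`. -/
noncomputable def conjE (e : E) : Module.End k (SemidirectAlgebra k φ) :=
  LinearMap.mulLeft k (grp k φ e) * LinearMap.mulRight k (grp k φ e⁻¹)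

theorem conjE_apply (e : E) (a : SemidirectAlgebra k φ) :
    conjE k φ e a = grp k φ e * a * grp k φ e⁻¹ := by
  simp [conjE, mul_assoc]

@[simp] theorem grp_mul_grp_inv (e : E) : grp k φ e * grp k φ e⁻¹ = 1 := by
  rw [← map_mul, mul_inv_cancel, map_one]

@[simp] theorem grp_inv_mul_grp (e : E) : grp k φ e⁻¹ * grp k φ e = 1 := by
  rw [← map_mul, inv_mul_cancel, map_one]

theorem conjE_conjE (e g : E) (a : SemidirectAlgebra k φ) :
    conjE k φ e (conjE k φ g a) = conjE k φ (e * g) a := by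
  rw [conjE_apply, conjE_apply, conjE_apply, map_mul, mul_inv_rev, map_mul]
  noncomm_ring

theorem conjE_emb (e : E) (x : MonoidAlgebra k P) :
    conjE k φ e (emb k φ x) = emb k φ (act k φ e x) := by
  rw [conjE_apply, grp_mul_emb, mul_assoc, grp_mul_grp_inv, mul_one]

theorem conjE_mul (e : E) (a b : SemidirectAlgebra k φ) :
    conjE k φ e (a * b) = conjE k φ e a * conjE k φ e b := by
  simp only [conjE_apply]
  calc _ = grp k φ e * a * 1 * b * grp k φ e⁻¹ := by noncomm_ring
    _ = _ := by rw [← grp_inv_mul_grp e]; noncomm_ring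

theorem coef_conjE (e g : E) (a : SemidirectAlgebra k φ) :
    coef k φ g (conjE k φ e a) = act k φ e (coef k φ (e⁻¹ * g * e) a) := by
  rw [conjE_apply, coef_mul_grp, coef_grp_mul, inv_inv, mul_assoc]

theorem der_conjE {f : DerAlg k (SemidirectAlgebra k φ)} (hf : ∀ e, f.1 (grp k φ e) = 0) (e : E)
    (a : SemidirectAlgebra k φ) : f.1 (conjE k φ e a) = conjE k φ e (f.1 a) := by
  rw [conjE_apply, der_mul_grp hf, der_grp_mul hf, conjE_apply]

variable (k φ) in
/-- The average of the conjugates by the elements of `E`. -/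
noncomputable def avgE [Fintype E] : Module.End k (SemidirectAlgebra k φ) :=
  (Fintype.card E : k)⁻¹ • ∑ e, conjE k φ e

theorem avgE_apply [Fintype E] (a : SemidirectAlgebra k φ) :
    avgE k φ a = (Fintype.card E : k)⁻¹ • ∑ e, conjE k φ e a := by
  simp [avgE]

theorem conjE_avgE [Fintype E] (g : E) (a : SemidirectAlgebra k φ) :
    conjE k φ g (avgE k φ a) = avgE k φ a := by
  rw [avgE_apply, map_smul, map_sum]
  simp only [conjE_conjE]
  rw [(Group.mulLeft_bijective g).sum_comp fun e => conjE k φ e a]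

theorem grp_commute_avgE [Fintype E] (g : E) (a : SemidirectAlgebra k φ) :
    grp k φ g * avgE k φ a = avgE k φ a * grp k φ g := by
  conv_rhs => rw [← conjE_avgE g a, conjE_apply, mul_assoc, grp_inv_mul_grp, mul_one]

/-- The map e ↦ f(e)e⁻¹ is a 1-cocycle of E for conjugation, and its average c satisfies f(e)e⁻¹ = c
- ece⁻¹. -/
theorem exists_sub_innerDer_vanish [Fintype E] (hE : (Fintype.card E : k) ≠ 0)
    (f : DerAlg k (SemidirectAlgebra k φ)) :
    ∃ c, ∀ e, (f - innerDer k c).1 (grp k φ e) = 0 := by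
  set c := (Fintype.card E : k)⁻¹ • ∑ e, f.1 (grp k φ e) * grp k φ e⁻¹ with hc
  refine ⟨c, fun g => ?_⟩
  have h1 : c = (Fintype.card E : k)⁻¹ • ∑ e, f.1 (grp k φ (g * e)) * grp k φ (g * e)⁻¹ := by
    rw [(Group.mulLeft_bijective g).sum_comp fun e => f.1 (grp k φ e) * grp k φ e⁻¹]
  have h2 : ∀ e, f.1 (grp k φ (g * e)) * grp k φ (g * e)⁻¹ =
      f.1 (grp k φ g) * grp k φ g⁻¹ + conjE k φ g (f.1 (grp k φ e) * grp k φ e⁻¹) := by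
    intro e
    rw [map_mul, DerAlg.leibniz, mul_inv_rev, map_mul, add_mul, conjE_apply]
    congr 1
    · calc _ = f.1 (grp k φ g) * (grp k φ e * grp k φ e⁻¹) * grp k φ g⁻¹ := by noncomm_ring
        _ = _ := by rw [grp_mul_grp_inv, mul_one]
    · noncomm_ring
  have h3 : c = f.1 (grp k φ g) * grp k φ g⁻¹ + conjE k φ g c := by
    conv_lhs => rw [h1]
    simp only [h2]
    rw [Finset.sum_add_distrib, smul_add, inv_card_smul_sum_const hE, ← map_sum, ← map_smul]
  have h4 := congrArg (· * grp k φ g) h3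
  simp only [add_mul, conjE_apply, mul_assoc, grp_inv_mul_grp, mul_one] at h4
  rw [DerAlg.sub_apply, innerDer_apply, h4, add_sub_cancel_right, sub_self]

/-! ### Coefficients at elements acting non-trivially on P -/

variable (k φ) in
/-- The elements whose coefficients at `e` are in the square of the augmentation ideal, for all
`e` acting non-trivially on `P`. -/
noncomputable def offKer : Submodule k (SemidirectAlgebra k φ) :=
  ⨅ e, ⨅ _ : e ∉ φ.ker, ((augIdeal k P ^ 2).restrictScalars k).comap (coef k φ e)

theorem mem_offKer {a : SemidirectAlgebra k φ} :
    a ∈ offKer k φ ↔ ∀ e ∉ φ.ker, coef k φ e a ∈ augIdeal k P ^ 2 := by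
  simp [offKer]

theorem conjE_mem_offKer {a : SemidirectAlgebra k φ} (ha : a ∈ offKer k φ) (e : E) :
    conjE k φ e a ∈ offKer k φ := by
  refine mem_offKer.2 fun g hg => ?_
  rw [coef_conjE]
  refine act_mem_augIdeal_pow φ e 2 (mem_offKer.1 ha _ fun h => hg ?_)
  have := (inferInstance : φ.ker.Normal).conj_mem _ h e
  simpa [mul_assoc] using this

theorem mul_emb_mem_offKer {a : SemidirectAlgebra k φ} (ha : a ∈ offKer k φ)
    (x : MonoidAlgebra k P) : a * emb k φ x ∈ offKer k φ :=
  mem_offKer.2 fun e he => by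
    rw [coef_mul_emb]
    exact Ideal.mul_mem_right _ _ (mem_offKer.1 ha e he)

theorem single_mul_single_inv (u : P) : (single u 1 * single u⁻¹ 1 : MonoidAlgebra k P) = 1 := by
  simp [one_def]

theorem emb_single_mul_inv (u : P) :
    emb k φ (single u 1) * emb k φ (single u⁻¹ 1) = 1 := by
  rw [← map_mul, single_mul_single_inv, map_one]

theorem emb_single_inv_mul (u : P) :
    emb k φ (single u⁻¹ 1) * emb k φ (single u 1) = 1 := by
  simpa using emb_single_mul_inv (k := k) (φ := φ) u⁻¹

theorem coef_conj_emb (e : E) (u : P) (a : SemidirectAlgebra k φ) :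
    coef k φ e (emb k φ (single u 1) * a * emb k φ (single u⁻¹ 1)) =
      single (twist (φ e) u) 1 * coef k φ e a := by
  rw [coef_mul_emb, coef_emb_mul, act_single, mul_right_comm, single_mul_single, map_inv,
    twist_apply, div_eq_mul_inv, mul_one]

/-- Each e ∉ C_E(P) gives a separate cocycle of P; the elements c_e correcting them assemble into
the single element ∑ c_e e. -/
theorem exists_sub_innerDer_offKer {p : ℕ} [Fact p.Prime] [CharP k p] [Finite P] [Fintype E]
    (hP : IsPGroup p P) (hE : ¬ p ∣ Fintype.card E) (f : DerAlg k (SemidirectAlgebra k φ)) :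
    ∃ c, ∀ u, (f - innerDer k c).1 (emb k φ (single u 1)) ∈ offKer k φ := by
  classical
  let d : E → P → MonoidAlgebra k P := fun e u =>
    coef k φ e (f.1 (emb k φ (single u 1)) * emb k φ (single u⁻¹ 1))
  have hd : ∀ e u v, d e (u * v) = d e u + single (twist (φ e) u) 1 * d e v := by
    intro e u v
    simp only [d]
    rw [← coef_conj_emb, ← map_add]
    congr 1
    rw [show (single (u * v) 1 : MonoidAlgebra k P) = single u 1 * single v 1 by simp,
      show (single (u * v)⁻¹ 1 : MonoidAlgebra k P) = single v⁻¹ 1 * single u⁻¹ 1 by simp,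
      map_mul (emb k φ), map_mul (emb k φ), DerAlg.leibniz, add_mul]
    congr 1
    · rw [mul_assoc, ← mul_assoc (emb k φ (single v 1)), emb_single_mul_inv, one_mul]
    · noncomm_ring
  have hex : ∀ e, ∃ c, e ∉ φ.ker → ∀ u,
      d e u - (c - single (twist (φ e) u) 1 * c) ∈ augIdeal k P ^ 2 := by
    intro e
    by_cases he : e ∈ φ.ker
    · exact ⟨0, fun h => absurd he h⟩
    · obtain ⟨c, hc⟩ := exists_coboundary_modEq hP hE
        (by rw [← map_pow, pow_card_eq_one, map_one]) he (d e) (hd e)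
      exact ⟨c, fun _ => hc⟩
  choose c hc using hex
  have hcoef : ∀ e, coef k φ e (∑ g, emb k φ (c g) * grp k φ g) = c e := by
    intro e
    simp [coef_emb_mul_grp]
  refine ⟨∑ g, emb k φ (c g) * grp k φ g, fun u => ?_⟩
  set C := ∑ g, emb k φ (c g) * grp k φ g
  have key : (f - innerDer k C).1 (emb k φ (single u 1)) * emb k φ (single u⁻¹ 1) ∈
      offKer k φ := by
    refine mem_offKer.2 fun e he => ?_
    have := hc e he u
    rw [← hcoef, ← coef_conj_emb] at this
    simp only [d] at this
    rw [← map_sub, ← map_sub] at this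
    convert this using 2
    rw [DerAlg.sub_apply, innerDer_apply, sub_mul, sub_mul, mul_assoc C, emb_single_mul_inv,
      mul_one]
  have := mul_emb_mem_offKer key (single u 1)
  rwa [mul_assoc, emb_single_inv_mul, mul_one] at this

/-- The correcting element may be averaged over E: the average commutes with E, so vanishing on E is
kept, and `offKer` is stable under conjugation. -/
theorem exists_sub_innerDer_offKer_vanish {p : ℕ} [Fact p.Prime] [CharP k p] [Finite P]
    [Fintype E] (hP : IsPGroup p P) (hE : ¬ p ∣ Fintype.card E)
    (f : DerAlg k (SemidirectAlgebra k φ)) (hf : ∀ e, f.1 (grp k φ e) = 0) :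
    ∃ c, (∀ e, (f - innerDer k c).1 (grp k φ e) = 0) ∧
      ∀ u, (f - innerDer k c).1 (emb k φ (single u 1)) ∈ offKer k φ := by
  obtain ⟨c, hc⟩ := exists_sub_innerDer_offKer hP hE f
  have hE' : (Fintype.card E : k) ≠ 0 := by rwa [Ne, CharP.cast_eq_zero_iff k p]
  refine ⟨avgE k φ c, fun e => ?_, fun u => ?_⟩
  · rw [DerAlg.sub_apply, hf, innerDer_apply, grp_commute_avgE, sub_self, sub_zero]
  · have h1 : (f - innerDer k (avgE k φ c)).1 (emb k φ (single u 1)) = (Fintype.card E : k)⁻¹ •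
        ∑ e, conjE k φ e ((f - innerDer k c).1 (emb k φ (single (φ e⁻¹ u) 1))) := by
      have h2 : ∀ e, emb k φ (single u 1) = conjE k φ e (emb k φ (single (φ e⁻¹ u) 1)) := by
        intro e
        rw [conjE_emb, act_single, map_inv, MulAut.apply_inv_self]
      have h3 : ∀ e, conjE k φ e ((f - innerDer k c).1 (emb k φ (single (φ e⁻¹ u) 1))) =
          f.1 (emb k φ (single u 1)) - (conjE k φ e c * emb k φ (single u 1) -
            emb k φ (single u 1) * conjE k φ e c) := by
        intro e
        rw [DerAlg.sub_apply, innerDer_apply, map_sub, map_sub, conjE_mul, conjE_mul, ← h2,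
          ← der_conjE hf, ← h2]
      simp only [h3]
      rw [Finset.sum_sub_distrib, smul_sub, inv_card_smul_sum_const hE', Finset.sum_sub_distrib,
        ← Finset.sum_mul, ← Finset.mul_sum, DerAlg.sub_apply, innerDer_apply, avgE_apply,
        smul_sub, smul_mul_assoc, mul_smul_comm]
    rw [h1]
    exact Submodule.smul_mem _ _ (Submodule.sum_mem _ fun e _ => conjE_mem_offKer (hc _) e)

/-- By the Leibniz rule, the augmentation of the coefficient is additive in u. It is E-invariant
since z is central and f commutes with conjugation, so it kills [P,E] = P. -/
theorem coef_mem_augIdeal_of_mem_ker {f : DerAlg k (SemidirectAlgebra k φ)}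
    (hf : ∀ e, f.1 (grp k φ e) = 0) (hPE : actionCommutator φ = ⊤) {z : E}
    (hz : z ∈ Subgroup.center E) (u : P) :
    coef k φ z (f.1 (emb k φ (single u 1))) ∈ augIdeal k P := by
  let χ : P →* Multiplicative k :=
    { toFun := fun u => Multiplicative.ofAdd
        (MonoidAlgebra.lift k k P 1 (coef k φ z (f.1 (emb k φ (single u 1)))))
      map_one' := by
        rw [← one_def, map_one (emb k φ), DerAlg.map_one]
        simp
      map_mul' := fun u v => by
        rw [show (single (u * v) 1 : MonoidAlgebra k P) = single u 1 * single v 1 by simp,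
          map_mul (emb k φ), DerAlg.leibniz, map_add, coef_mul_emb, coef_emb_mul, map_add, map_mul,
          map_mul, act_single]
        simp [ofAdd_add] }
  have hker : actionCommutator φ ≤ χ.ker := by
    refine (Subgroup.closure_le _).2 ?_
    rintro _ ⟨e, u, rfl⟩
    have h1 : χ (φ e u) = χ u := by
      change Multiplicative.ofAdd _ = Multiplicative.ofAdd _
      congr 1
      rw [← act_single, ← conjE_emb, der_conjE hf, coef_conjE]
      have : e⁻¹ * z * e = z := by
        rw [mul_assoc, ← Subgroup.mem_center_iff.1 hz e, inv_mul_cancel_left]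
      rw [this]
      generalize coef k φ z (f.1 (emb k φ (single u 1))) = x
      induction x using induction_linear with
      | zero => simp
      | add x y hx hy => simp only [map_add, hx, hy]
      | single u r => simp
    change χ (φ e u * u⁻¹) = 1
    rw [map_mul, map_inv, h1, mul_inv_cancel]
  have : u ∈ χ.ker := hker (hPE ▸ Subgroup.mem_top u)
  exact this

variable (k φ) in
/-- The derivations vanishing on `E` with values on `P` in the radical, and with coefficients in
the square of the augmentation ideal at the elements of `E` acting non-trivially on `P`. -/
def IsNormalized (f : DerAlg k (SemidirectAlgebra k φ)) : Prop :=
  f ∈ derFil k φ 0 ∧ ∀ u, f.1 (emb k φ (single u 1)) ∈ offKer k φ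

theorem exists_isNormalized {p : ℕ} [Fact p.Prime] [CharP k p] [Finite P]
    [Finite E] (hP : IsPGroup p P) (hE : ¬ p ∣ Nat.card E) (hPE : actionCommutator φ = ⊤)
    (hcentral : φ.ker ≤ Subgroup.center E) (c : HHOne k (SemidirectAlgebra k φ)) :
    ∃ f, LieSubmodule.Quotient.mk f = c ∧ IsNormalized k φ f := by
  have := Fintype.ofFinite E
  rw [Nat.card_eq_fintype_card] at hE
  have hE' : (Fintype.card E : k) ≠ 0 := by rwa [Ne, CharP.cast_eq_zero_iff k p]
  obtain ⟨f, rfl⟩ := Submodule.Quotient.mk_surjective _ c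
  obtain ⟨a, ha⟩ := exists_sub_innerDer_vanish hE' f
  obtain ⟨b, hb, hb'⟩ := exists_sub_innerDer_offKer_vanish hP hE _ ha
  refine ⟨f - innerDer k a - innerDer k b, ?_, ⟨hb, fun u => ?_⟩, hb'⟩
  · rw [HHOne.mk_sub_innerDer, HHOne.mk_sub_innerDer]
  · refine mem_fil.2 fun e => ?_
    by_cases he : e ∈ φ.ker
    · simpa using coef_mem_augIdeal_of_mem_ker hb hPE (hcentral he) u
    · exact Ideal.pow_le_pow_right (by norm_num) (mem_offKer.1 (hb' u) e he)

end SemidirectAlgebra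

/-! ### Solvability from a cyclic Frattini quotient -/

namespace SemidirectAlgebra

variable {k P E : Type*} [Field k] [CommGroup P] [Group E] {φ : E →* MulAut P}

/-- One step better than `der_mem_fil` with n = 0; for m = 0 it places the whole image in the
radical. -/
theorem der_apply_mem_fil [Finite E] {m : ℕ} {f : DerAlg k (SemidirectAlgebra k φ)}
    (hf : f ∈ derFil k φ m) (a : SemidirectAlgebra k φ) : f.1 a ∈ fil k φ (m + 1) := by
  refine fil_induction (n := 0) (S := (fil k φ (m + 1)).comap f.1) (fun x _ e => ?_)
    (mem_fil_zero a)
  rw [Submodule.mem_comap, der_mul_grp hf.1]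
  exact mul_mem_fil_left (der_emb_mem_fil hf x) _

variable (k φ) in
/-- The operators spanned by the conjugations by elements of `E` composed with the
multiplications by elements acting trivially on `P`. -/
noncomputable def twistedConj : Submodule k (Module.End k (SemidirectAlgebra k φ)) :=
  Submodule.span k {t | ∃ e, ∃ z ∈ φ.ker, t = conjE k φ e * LinearMap.mulRight k (grp k φ z)}

theorem conjE_mulRight_apply (hcentral : φ.ker ≤ Subgroup.center E) (e : E) {z w : E}
    (hz : z ∈ φ.ker) (hw : w ∈ φ.ker) (x : MonoidAlgebra k P) :
    (conjE k φ e * LinearMap.mulRight k (grp k φ z)) (emb k φ x * grp k φ w) =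
      emb k φ (act k φ e x) * grp k φ (w * z) := by
  rw [Module.End.mul_apply, LinearMap.mulRight_apply, conjE_apply, mul_assoc (emb k φ x),
    ← map_mul, ← mul_assoc, grp_mul_emb, mul_assoc, mul_assoc, ← map_mul, ← map_mul,
    ← Subgroup.mem_center_iff.1 (hcentral (φ.ker.mul_mem hw hz)) e⁻¹, mul_inv_cancel_left]

/-- On kP both composites send x to the image of x under eg, times zw: conjugation fixes the central
z and w, and e, g commute in their action on P. -/
theorem twistedConj_commute (hcentral : φ.ker ≤ Subgroup.center E)
    (hab : ∀ e g, φ (e * g) = φ (g * e))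
    {s t : Module.End k (SemidirectAlgebra k φ)} (hs : s ∈ twistedConj k φ)
    (ht : t ∈ twistedConj k φ) (x : MonoidAlgebra k P) :
    s (t (emb k φ x)) = t (s (emb k φ x)) := by
  induction hs, ht using Submodule.span_induction₂ with
  | mem_mem s t hs ht =>
    obtain ⟨e, z, hz, rfl⟩ := hs
    obtain ⟨g, w, hw, rfl⟩ := ht
    have h1 : emb k φ x = emb k φ x * grp k φ 1 := by simp
    rw [h1, conjE_mulRight_apply hcentral g hw φ.ker.one_mem,
      conjE_mulRight_apply hcentral e hz φ.ker.one_mem, one_mul, one_mul,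
      conjE_mulRight_apply hcentral _ hz hw, conjE_mulRight_apply hcentral _ hw hz,
      act_act, act_act, Subgroup.mem_center_iff.1 (hcentral hz) w]
    congr 2
    simp only [act, hab e g]
  | zero_left => simp
  | zero_right => simp
  | add_left s s' t _ _ _ h h' => simp only [LinearMap.add_apply, map_add, h, h']
  | add_right s t t' _ _ _ h h' => simp only [LinearMap.add_apply, map_add, h, h']
  | smul_left r s t _ _ h => simp only [LinearMap.smul_apply, map_smul, h]
  | smul_right r s t _ _ h => simp only [LinearMap.smul_apply, map_smul, h]

theorem der_twistedConj {f : DerAlg k (SemidirectAlgebra k φ)} (hf : ∀ e, f.1 (grp k φ e) = 0)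
    {t : Module.End k (SemidirectAlgebra k φ)} (ht : t ∈ twistedConj k φ)
    (a : SemidirectAlgebra k φ) : f.1 (t a) = t (f.1 a) := by
  induction ht using Submodule.span_induction with
  | mem t ht =>
    obtain ⟨e, z, -, rfl⟩ := ht
    rw [Module.End.mul_apply, Module.End.mul_apply, der_conjE hf, LinearMap.mulRight_apply,
      LinearMap.mulRight_apply, der_mul_grp hf]
  | zero => simp
  | add s t _ _ hs ht => simp only [LinearMap.add_apply, map_add, hs, ht]
  | smul r t _ ht => simp only [LinearMap.smul_apply, map_smul, ht]

theorem conjE_mem_fil [Finite E] {n : ℕ} (e : E) {a : SemidirectAlgebra k φ}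
    (ha : a ∈ fil k φ n) : conjE k φ e a ∈ fil k φ n := by
  rw [conjE_apply]
  exact mul_mem_fil_left (mul_mem_fil_right ha _) _

theorem twistedConj_mem_fil [Finite E] {n : ℕ} {t : Module.End k (SemidirectAlgebra k φ)}
    (ht : t ∈ twistedConj k φ) {a : SemidirectAlgebra k φ} (ha : a ∈ fil k φ n) :
    t a ∈ fil k φ n := by
  induction ht using Submodule.span_induction with
  | mem t ht =>
    obtain ⟨e, z, -, rfl⟩ := ht
    rw [Module.End.mul_apply, LinearMap.mulRight_apply]
    exact conjE_mem_fil _ (mul_mem_fil_left ha _)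
  | zero => simp
  | add s t _ _ hs ht => rw [LinearMap.add_apply]; exact add_mem hs ht
  | smul r t _ ht => rw [LinearMap.smul_apply]; exact Submodule.smul_mem _ r ht

theorem conjE_mul_mem_twistedConj (e : E) {t : Module.End k (SemidirectAlgebra k φ)}
    (ht : t ∈ twistedConj k φ) : conjE k φ e * t ∈ twistedConj k φ := by
  induction ht using Submodule.span_induction with
  | mem t ht =>
    obtain ⟨g, z, hz, rfl⟩ := ht
    refine Submodule.subset_span ⟨e * g, z, hz, ?_⟩
    rw [← mul_assoc, show conjE k φ e * conjE k φ g = conjE k φ (e * g) from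
      LinearMap.ext fun a => conjE_conjE e g a]
  | zero => simp
  | add s t _ _ hs ht => rw [mul_add]; exact add_mem hs ht
  | smul r t _ ht => rw [mul_smul_comm]; exact Submodule.smul_mem _ r ht

/-- The element `v` generates `P` as a group with action of `E`. -/
def IsActionGenerator (φ : E →* MulAut P) (v : P) : Prop :=
  ∀ K : Subgroup P, (∀ e, ∀ u ∈ K, φ e u ∈ K) → v ∈ K → K = ⊤

/-- Coefficients off C_E(P) are already in I². For z ∈ C_E(P), the u with (u - 1)z in the desired
space N form an E-stable subgroup containing v, hence all of P. -/
theorem exists_twistedConj_modEq [Finite E] (hcentral : φ.ker ≤ Subgroup.center E) {v : P}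
    (hv : IsActionGenerator φ v) {a : SemidirectAlgebra k φ} (ha : a ∈ fil k φ 1)
    (ha' : a ∈ offKer k φ) :
    ∃ t ∈ twistedConj k φ, a - t (emb k φ (single v 1 - 1)) ∈ fil k φ 2 := by
  set w := emb k φ (single v 1 - 1)
  let N := (twistedConj k φ).map (LinearMap.applyₗ w) ⊔ fil k φ 2
  have hN : ∀ e, ∀ b ∈ N, conjE k φ e b ∈ N := by
    intro e b hb
    obtain ⟨_, ⟨t, ht, rfl⟩, c, hc, rfl⟩ := Submodule.mem_sup.1 hb
    rw [map_add]
    exact add_mem (Submodule.mem_sup_left ⟨_, conjE_mul_mem_twistedConj e ht, rfl⟩)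
      (Submodule.mem_sup_right (conjE_mem_fil e hc))
  have hker : ∀ z ∈ φ.ker, ∀ x ∈ augIdeal k P, emb k φ x * grp k φ z ∈ N := by
    intro z hz x hx
    let S : Submodule k (MonoidAlgebra k P) :=
      N.comap (LinearMap.mulRight k (grp k φ z) ∘ₗ (emb k φ).toLinearMap)
    have hS : ∀ x ∈ augIdeal k P ^ 2, x ∈ S := fun x hx =>
      Submodule.mem_sup_right (emb_mul_grp_mem_fil hx z)
    have htop : unipotentSubgroup S hS = ⊤ := by
      refine hv _ (fun e u hu => ?_) ?_
      · have := hN e _ hu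
        have h1 := conjE_mulRight_apply hcentral e hz φ.ker.one_mem (single u (1 : k) - 1)
        rw [map_one, mul_one, one_mul] at h1
        change conjE k φ e (emb k φ (single u (1 : k) - 1) * grp k φ z) = _ at h1
        change conjE k φ e (emb k φ (single u (1 : k) - 1) * grp k φ z) ∈ N at this
        rw [h1, map_sub, map_one, act_single] at this
        exact this
      · refine Submodule.mem_sup_left ⟨conjE k φ 1 * LinearMap.mulRight k (grp k φ z),
          Submodule.subset_span ⟨1, z, hz, rfl⟩, ?_⟩
        simp [conjE_apply, w, sub_mul]
    exact augIdeal_le S (fun u => show u ∈ unipotentSubgroup S hS from htop ▸ Subgroup.mem_top u) hx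
  have haN : a ∈ N := by
    have := Fintype.ofFinite E
    rw [eq_sum_coef a]
    refine Submodule.sum_mem _ fun e _ => ?_
    by_cases he : e ∈ φ.ker
    · exact hker e he _ (by simpa using mem_fil.1 ha e)
    · exact Submodule.mem_sup_right (emb_mul_grp_mem_fil (mem_offKer.1 ha' e he) e)
  obtain ⟨_, ⟨t, ht, rfl⟩, c, hc, rfl⟩ := Submodule.mem_sup.1 haN
  refine ⟨t, ht, ?_⟩
  simpa using hc

/-- The u whose image under the bracket lies in the second step form an E-stable subgroup, so u = v
suffices. With w = v - 1, fw ≡ tw and gw ≡ sw, one gets fgw ≡ sfw ≡ stw = tsw ≡ tgw ≡ gfw modulo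
that step. -/
theorem lie_mem_derFil_one [Finite E] (hcentral : φ.ker ≤ Subgroup.center E)
    (hab : ∀ e g, φ (e * g) = φ (g * e)) {v : P} (hv : IsActionGenerator φ v)
    {f g : DerAlg k (SemidirectAlgebra k φ)} (hf : IsNormalized k φ f)
    (hg : IsNormalized k φ g) : ⁅f, g⁆ ∈ derFil k φ 1 := by
  have hfg := lie_mem_derFil hf.1 hg.1
  refine ⟨hfg.1, fun u => ?_⟩
  let K : Subgroup P :=
    { carrier := {u | (⁅f, g⁆ : DerAlg k (SemidirectAlgebra k φ)).1 (emb k φ (single u 1)) ∈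
        fil k φ 2}
      one_mem' := by
        rw [Set.mem_ofPred_eq, ← one_def, map_one (emb k φ), DerAlg.map_one]
        exact zero_mem _
      mul_mem' := fun {u v} hu hv => by
        rw [Set.mem_ofPred_eq,
          show (single (u * v) 1 : MonoidAlgebra k P) = single u 1 * single v 1 by simp,
          map_mul (emb k φ), DerAlg.leibniz]
        exact add_mem (mul_mem_fil_left hu _) (mul_mem_fil_right hv _)
      inv_mem' := fun {u} hu => by
        have h := DerAlg.leibniz ⁅f, g⁆ (emb k φ (single u⁻¹ 1)) (emb k φ (single u 1))
        rw [emb_single_inv_mul, DerAlg.map_one] at h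
        have h' := congrArg (· * emb k φ (single u⁻¹ 1)) h
        simp only [zero_mul, add_mul] at h'
        rw [mul_assoc, emb_single_mul_inv, mul_one] at h'
        rw [Set.mem_ofPred_eq, eq_neg_of_add_eq_zero_left h'.symm]
        exact neg_mem (mul_mem_fil_left (mul_mem_fil_right hu _) _) }
  suffices hK : K = ⊤ from show u ∈ K by rw [hK]; exact Subgroup.mem_top u
  refine hv K (fun e u hu => ?_) ?_
  · change (⁅f, g⁆ : DerAlg k (SemidirectAlgebra k φ)).1 (emb k φ (single (φ e u) 1)) ∈ fil k φ 2
    rw [← act_single, ← conjE_emb, der_conjE hfg.1]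
    exact conjE_mem_fil e hu
  · change (⁅f, g⁆ : DerAlg k (SemidirectAlgebra k φ)).1 (emb k φ (single v 1)) ∈ fil k φ 2
    have hw : ∀ h : DerAlg k (SemidirectAlgebra k φ), h.1 (emb k φ (single v 1)) =
        h.1 (emb k φ (single v 1 - 1)) := fun h => by
      rw [map_sub (emb k φ), map_one (emb k φ), map_sub h.1, DerAlg.map_one, sub_zero]
    obtain ⟨t, ht, hft⟩ := exists_twistedConj_modEq hcentral hv (hf.1.2 v) (hf.2 v)
    obtain ⟨s, hs, hgs⟩ := exists_twistedConj_modEq hcentral hv (hg.1.2 v) (hg.2 v)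
    rw [hw] at hft hgs
    rw [DerAlg.lie_apply, hw f, hw g]
    set w := emb k φ (single v 1 - 1) with hwdef
    have h1 := der_mem_fil hf.1 hgs
    have h2 := der_mem_fil hg.1 hft
    rw [map_sub, der_twistedConj hf.1.1 hs] at h1
    rw [map_sub, der_twistedConj hg.1.1 ht] at h2
    have h3 := twistedConj_mem_fil hs hft
    have h4 := twistedConj_mem_fil ht hgs
    rw [map_sub] at h3 h4
    rw [twistedConj_commute hcentral hab hs ht] at h3
    have := add_mem (sub_mem h1 h2) (sub_mem h3 h4)
    convert this using 1
    abel

theorem isSolvable_of_isActionGenerator {p : ℕ} [Fact p.Prime] [CharP k p] [Finite P]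
    [Finite E] (hP : IsPGroup p P) (hE : ¬ p ∣ Nat.card E) (hPE : actionCommutator φ = ⊤)
    (hcentral : φ.ker ≤ Subgroup.center E) (hab : ∀ e g, φ (e * g) = φ (g * e)) {v : P}
    (hv : IsActionGenerator φ v) : LieAlgebra.IsSolvable (HHOne k (SemidirectAlgebra k φ)) := by
  let π : DerAlg k (SemidirectAlgebra k φ) →ₗ[k] HHOne k (SemidirectAlgebra k φ) :=
    (IDerAlg k (SemidirectAlgebra k φ)).toSubmodule.mkQ
  have hπ : ∀ f g : DerAlg k (SemidirectAlgebra k φ), ⁅π f, π g⁆ = π ⁅f, g⁆ := fun f g => rfl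
  let D := LieAlgebra.derivedSeries k (HHOne k (SemidirectAlgebra k φ))
  have hD : ∀ n (S : Submodule k (HHOne k (SemidirectAlgebra k φ))),
      (∀ x ∈ D n, ∀ y ∈ D n, ⁅x, y⁆ ∈ S) → (D (n + 1)).toSubmodule ≤ S := by
    intro n S h
    change (LieAlgebra.derivedSeriesOfIdeal k _ (n + 1) ⊤).toSubmodule ≤ S
    rw [LieAlgebra.derivedSeriesOfIdeal_succ, LieSubmodule.lieIdeal_oper_eq_linear_span',
      Submodule.span_le]
    rintro _ ⟨x, hx, y, hy, rfl⟩
    exact h x hx y hy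
  have key : ∀ n, (D (n + 1)).toSubmodule ≤ (derFil k φ (n + 1)).map π := by
    intro n
    induction n with
    | zero =>
      refine hD _ _ fun x _ y _ => ?_
      obtain ⟨f, rfl, hf⟩ := exists_isNormalized hP hE hPE hcentral x
      obtain ⟨g, rfl, hg⟩ := exists_isNormalized hP hE hPE hcentral y
      exact ⟨⁅f, g⁆, lie_mem_derFil_one hcentral hab hv hf hg, hπ f g⟩
    | succ n ih =>
      refine hD _ _ fun x hx y hy => ?_
      obtain ⟨f, hf, rfl⟩ := ih hx
      obtain ⟨g, hg, rfl⟩ := ih hy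
      -- The bracket has level 2(n + 1), which is at least n + 2. The first derived term needed the
      -- commutation argument, since level 0 brackets gain nothing from degrees.
      exact ⟨⁅f, g⁆, derFil_antitone (by omega) (lie_mem_derFil hf hg), hπ f g⟩
  obtain ⟨n, hn⟩ := exists_fil_eq_bot (k := k) (φ := φ) hP
  refine LieAlgebra.IsSolvable.mk (R := k) (k := n + 1) ((LieSubmodule.eq_bot_iff _).2 fun x hx => ?_)
  obtain ⟨f, hf, rfl⟩ := key n hx
  rw [eq_zero_of_mem_derFil hn (derFil_antitone (Nat.le_succ n) hf), map_zero]

end SemidirectAlgebra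

/-! ### Multiplicity free modules -/

section MultiplicityFree

variable {R M : Type*} [Ring R] [AddCommGroup M] [Module R M]

/-- Take the sum of one non-zero vector from each summand. A summand outside a maximal submodule C
is isomorphic to M/C, so there is exactly one; if C contained the sum, it would contain that
summand's vector, which injectivity into M/C forbids. -/
theorem IsMultiplicityFree.exists_generator [Finite M] (h : IsMultiplicityFree R M) :
    ∃ v : M, ∀ N : Submodule R M, v ∈ N → N = ⊤ := by
  classical
  obtain ⟨𝒮, -, htop, hsimple, hpair⟩ := h
  have : Finite (Submodule R M) := Finite.of_injective _ SetLike.coe_injective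
  have := Fintype.ofFinite 𝒮
  have hex : ∀ S : 𝒮, ∃ s : (S : Submodule R M), s ≠ 0 := fun S => by
    have := hsimple S S.2
    have := IsSimpleModule.nontrivial R (S : Submodule R M)
    exact exists_ne 0
  choose s hs using hex
  refine ⟨∑ S, (s S : M), fun N hN => ?_⟩
  by_contra hne
  obtain ⟨C, hC, hNC⟩ := (eq_top_or_exists_le_coatom N).resolve_left hne
  have hU : IsSimpleModule R (M ⧸ C) := isSimpleModule_iff_isCoatom.2 hC
  have hbij : ∀ S : 𝒮, ¬ (S : Submodule R M) ≤ C →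
      Function.Bijective (C.mkQ ∘ₗ (S : Submodule R M).subtype) := by
    intro S hS
    have := hsimple S S.2
    refine (LinearMap.bijective_or_eq_zero _).resolve_right fun h0 => hS fun x hx => ?_
    have := LinearMap.congr_fun h0 ⟨x, hx⟩
    simpa using this
  obtain ⟨S, hS⟩ : ∃ S : 𝒮, ¬ (S : Submodule R M) ≤ C := by
    by_contra! hall
    exact hC.1 (top_le_iff.1 (htop ▸ sSup_le fun S hS => hall ⟨S, hS⟩))
  have hother : ∀ T : 𝒮, T ≠ S → (T : Submodule R M) ≤ C := by
    intro T hTS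
    by_contra hT
    exact (hpair T.2 S.2 fun h => hTS (Subtype.ext h)).false
      ((LinearEquiv.ofBijective _ (hbij T hT)).trans (LinearEquiv.ofBijective _ (hbij S hS)).symm)
  have hsum : ∑ T, (s T : M) ∈ C := hNC hN
  rw [← Finset.add_sum_erase _ _ (Finset.mem_univ S)] at hsum
  have hsS : (s S : M) ∈ C := (Submodule.add_mem_iff_left C (Submodule.sum_mem _ fun T hT =>
    hother T (Finset.ne_of_mem_erase hT) (s T).2)).1 hsum
  refine hs S ((hbij S hS).1 ?_)
  rw [map_zero]
  simpa using hsS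

theorem exists_sl2_of_not_isMultiplicityFree [IsSemisimpleModule R M]
    (h : ¬ IsMultiplicityFree R M) :
    ∃ x y h : Module.End R M, x ≠ 0 ∧ x * y - y * x = h ∧ h * x - x * h = x + x ∧
      h * y - y * h = -(y + y) := by
  obtain ⟨𝒮, hind, htop, hsimple⟩ := IsSemisimpleModule.exists_sSupIndep_sSup_simples_eq_top R M
  have hpair : ¬ 𝒮.Pairwise fun S T => IsEmpty (S ≃ₗ[R] T) := fun hp =>
    h ⟨𝒮, hind, htop, hsimple, hp⟩
  simp only [Set.Pairwise, not_forall, not_isEmpty_iff] at hpair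
  obtain ⟨S, hS, T, hT, hne, ⟨i⟩⟩ := hpair
  have hcompl : ∀ U ∈ 𝒮, IsCompl U (sSup (𝒮 \ {U})) := fun U hU =>
    ⟨hind hU, codisjoint_iff.2 (by
      rw [← sSup_insert, Set.insert_sdiff_singleton, Set.insert_eq_of_mem hU, htop])⟩
  let πS := S.projectionOnto _ (hcompl S hS)
  let πT := T.projectionOnto _ (hcompl T hT)
  have hSS : ∀ a : S, πS (a : M) = a := fun a => Submodule.projectionOnto_apply_left _ a
  have hTT : ∀ a : T, πT (a : M) = a := fun a => Submodule.projectionOnto_apply_left _ a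
  have hST : ∀ a : T, πS (a : M) = 0 := fun a =>
    (Submodule.projectionOnto_apply_eq_zero_iff (hcompl S hS)).2
      (le_sSup (show T ∈ 𝒮 \ {S} from ⟨hT, hne.symm⟩) a.2)
  have hTS : ∀ a : S, πT (a : M) = 0 := fun a =>
    (Submodule.projectionOnto_apply_eq_zero_iff (hcompl T hT)).2
      (le_sSup (show S ∈ 𝒮 \ {T} from ⟨hS, hne⟩) a.2)
  let x : Module.End R M := S.subtype ∘ₗ i.symm.toLinearMap ∘ₗ πT
  let y : Module.End R M := T.subtype ∘ₗ i.toLinearMap ∘ₗ πS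
  -- The third element is xy - yx, the projection to S minus the projection to T; x and y are the
  -- matrix units exchanging S and T.
  refine ⟨x, y, _, fun hx => ?_, rfl, ?_, ?_⟩
  · have := hsimple T hT
    have := IsSimpleModule.nontrivial R T
    obtain ⟨a, ha⟩ := exists_ne (0 : T)
    have := LinearMap.congr_fun hx (a : M)
    simp only [x, LinearMap.comp_apply, hTT, Submodule.subtype_apply, LinearMap.zero_apply,
      ZeroMemClass.coe_eq_zero, LinearEquiv.coe_coe, LinearEquiv.map_eq_zero_iff] at this
    exact ha this
  · ext m
    simp [x, y, hSS, hTT, hTS]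
  · ext m
    simp [x, y, hSS, hTT, hST]
    abel

end MultiplicityFree

/-! ### The Frattini quotient as a module -/

section FrattiniQuotient

variable {P E : Type*} [CommGroup P] [Group E] [Finite P] {p : ℕ} [Fact p.Prime]

theorem exists_isActionGenerator (hP : IsPGroup p P) (φ : E →* MulAut P)
    (h : FrattiniQuotientMultiplicityFree hP φ) :
    ∃ v, SemidirectAlgebra.IsActionGenerator φ v := by
  let := frattiniQuotientModule hP
  set ρ := frattiniQuotientRep hP φ with hρ
  have : Finite ρ.asModule := inferInstanceAs (Finite (P ⧸ frattini P))
  obtain ⟨v, hv⟩ := IsMultiplicityFree.exists_generator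
    (R := MonoidAlgebra (ZMod p) E) (M := ρ.asModule) h
  obtain ⟨u, hu⟩ := QuotientGroup.mk_surjective (s := frattini P) (ρ.asModuleEquiv v).toMul
  refine ⟨u, fun K hK huK => ?_⟩
  let W : AddSubgroup (Additive (P ⧸ frattini P)) :=
    Subgroup.toAddSubgroup (K.map (QuotientGroup.mk' (frattini P)))
  have hW : ∀ (e : E), ∀ w ∈ W, ρ e w ∈ W := by
    rintro e _ ⟨a, ha, rfl⟩
    exact ⟨φ e a, hK e a ha, rfl⟩
  let N : Submodule (MonoidAlgebra (ZMod p) E) ρ.asModule :=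
    MonoidAlgebra.submoduleOfSMulMem (S := ZMod p) (AddSubgroup.toZModSubmodule p W)
      (fun e w hw => by
        rw [MonoidAlgebra.of_apply, Representation.single_smul, one_smul]
        exact hW e _ hw)
  have hN : N = ⊤ := hv N (by
    change v ∈ W
    exact ⟨u, huK, hu⟩)
  -- The image of K fills P/Φ(P), so K and Φ(P) generate P, and Φ(P) can be omitted.
  refine frattini_nongenerating (top_le_iff.1 fun a _ => ?_)
  have ha : ρ.asModuleEquiv.symm (Additive.ofMul (a : P ⧸ frattini P)) ∈ N := hN ▸ Submodule.mem_top
  obtain ⟨b, hb, hab⟩ : Additive.ofMul (a : P ⧸ frattini P) ∈ W := ha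
  have hba : (b : P ⧸ frattini P) = (a : P ⧸ frattini P) := hab
  rw [QuotientGroup.eq] at hba
  have := Subgroup.mul_mem_sup hb hba
  rwa [mul_inv_cancel_left] at this

end FrattiniQuotient

/-! ### The Frattini subgroup and the augmentation ideal -/

section Frattini

variable {P : Type*} [CommGroup P] {p : ℕ} [Fact p.Prime]

theorem isCoatom_ker_of_ne_one {χ : P →* Multiplicative (ZMod p)} {x : P} (hx : χ x ≠ 1) :
    IsCoatom χ.ker := by
  refine ⟨fun h => hx (MonoidHom.mem_ker.1 (h ▸ Subgroup.mem_top x)), fun K hK => ?_⟩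
  obtain ⟨b, hb, hbχ⟩ := SetLike.exists_of_lt hK
  refine top_le_iff.1 fun a _ => ?_
  have hb0 : (χ b).toAdd ≠ 0 := fun h => hbχ (MonoidHom.mem_ker.2 (toAdd_eq_zero.1 h))
  let n := ((χ a).toAdd / (χ b).toAdd).val
  have hn : χ (a * (b ^ n)⁻¹) = 1 := by
    rw [← toAdd_eq_zero, map_mul, map_inv, map_pow, toAdd_mul, toAdd_inv, toAdd_pow,
      nsmul_eq_mul, ZMod.natCast_val, ZMod.cast_id', id, div_mul_cancel₀ _ hb0, add_neg_cancel]
  have := K.mul_mem (hK.le (MonoidHom.mem_ker.2 hn)) (K.pow_mem hb n)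
  rwa [inv_mul_cancel_right] at this

theorem exists_addMonoidHom_eq_on_basis {ι V W : Type*} [AddCommGroup V] [Module (ZMod p) V]
    [AddCommGroup W] (b : Module.Basis ι (ZMod p) V) (hW : ∀ y : W, p • y = 0) (x : ι → W) :
    ∃ s : V →+ W, ∀ i, s (b i) = x i := by
  let : Module (ZMod p) W := AddCommGroup.zmodModule hW
  exact ⟨(b.constr (ZMod p) x).toAddMonoidHom, fun i => b.constr_basis (ZMod p) x i⟩

theorem exists_addMonoidHom_ne_zero_of_module {V : Type*} [AddCommGroup V] [Module (ZMod p) V]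
    {x : V} (hx : x ≠ 0) : ∃ f : V →+ ZMod p, f x ≠ 0 := by
  obtain ⟨f, hf⟩ := Module.Projective.exists_dual_ne_zero (ZMod p) hx
  exact ⟨f.toAddMonoidHom, hf⟩

theorem exists_addMonoidHom_ne_zero {V : Type*} [AddCommGroup V] (hV : ∀ y : V, p • y = 0)
    {x : V} (hx : x ≠ 0) : ∃ f : V →+ ZMod p, f x ≠ 0 := by
  let : Module (ZMod p) V := AddCommGroup.zmodModule hV
  exact exists_addMonoidHom_ne_zero_of_module hx

variable (k : Type*) [Field k]

/-- Let H be the subgroup of u with u - 1 ∈ I². Since v^p - 1 = (v - 1)^p, P/H has exponent p;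
characters to 𝔽_p separate its points, and their kernels are maximal subgroups or P. -/
theorem single_sub_one_mem_of_mem_frattini {p : ℕ} [Fact p.Prime] [CharP k p] {u : P} (hu : u ∈ frattini P) :
    single u 1 - 1 ∈ augIdeal k P ^ 2 := by
  let H := unipotentSubgroup ((augIdeal k P ^ 2).restrictScalars k) fun x hx => by
    exact hx
  by_contra hne
  have : CharP (MonoidAlgebra k P) p := charP_of_injective_algebraMap
    (FaithfulSMul.algebraMap_injective k (MonoidAlgebra k P)) p
  have hpow : ∀ v : P, v ^ p ∈ H := fun v => by
    change single (v ^ p) 1 - 1 ∈ augIdeal k P ^ 2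
    rw [show (single (v ^ p) 1 - 1 : MonoidAlgebra k P) = (single v 1 - 1) ^ p by
      rw [sub_pow_char, single_pow, one_pow, one_pow]]
    exact Ideal.pow_le_pow_right (Fact.out : p.Prime).two_le
      (Ideal.pow_mem_pow (single_sub_one_mem_augIdeal v) p)
  have hexp : ∀ x : Additive (P ⧸ H), p • x = 0 := fun x => by
    obtain ⟨v, hv⟩ := QuotientGroup.mk_surjective x.toMul
    apply Additive.toMul.injective
    rw [toMul_nsmul, ← hv, ← QuotientGroup.mk_pow]
    exact (QuotientGroup.eq_one_iff _).2 (hpow v)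
  have hu0 : Additive.ofMul (u : P ⧸ H) ≠ 0 := fun h => hne ((QuotientGroup.eq_one_iff _).1 h)
  obtain ⟨f, hf⟩ := exists_addMonoidHom_ne_zero hexp hu0
  let χ : P →* Multiplicative (ZMod p) :=
    (AddMonoidHom.toMultiplicativeRight f).comp (QuotientGroup.mk' H)
  have hχ : χ u ≠ 1 := hf
  exact hχ (MonoidHom.mem_ker.1 (frattini_le_coatom (isCoatom_ker_of_ne_one hχ) hu))

/-- The map `cl` identifies `P / Φ(P)` with the additive group `V`. -/
structure IsFrattiniClass {V : Type*} [AddCommGroup V] (cl : P → V) : Prop where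
  map_mul : ∀ u v, cl (u * v) = cl u + cl v
  surjective : Function.Surjective cl
  eq_zero_iff : ∀ u, cl u = 0 ↔ u ∈ frattini P

namespace IsFrattiniClass

variable {V : Type*} [AddCommGroup V] {cl : P → V}

theorem map_one (h : IsFrattiniClass cl) : cl 1 = 0 := (h.eq_zero_iff 1).2 (frattini P).one_mem

theorem map_inv (h : IsFrattiniClass cl) (u : P) : cl u⁻¹ = -cl u := by
  rw [eq_neg_iff_add_eq_zero, ← h.map_mul, inv_mul_cancel, h.map_one]

variable {k}

theorem single_sub_one_modEq [CharP k p] (h : IsFrattiniClass cl) {u v : P}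
    (huv : cl u = cl v) :
    (single u (1 : k) - 1) - (single v 1 - 1) ∈ augIdeal k P ^ 2 := by
  have hmem : v⁻¹ * u ∈ frattini P := by
    rw [← h.eq_zero_iff, h.map_mul, h.map_inv, huv, neg_add_cancel]
  have := Ideal.mul_mem_left _ (single v 1) (single_sub_one_mem_of_mem_frattini k (p := p) hmem)
  rw [mul_sub, single_mul_single, mul_inv_cancel_left, mul_one, mul_one] at this
  simpa using this

variable [Module (ZMod p) V]

/-- A functional on P/Φ(P) extends to a k-linear form on kP that is a derivation along the
augmentation, and so kills I². -/
theorem mem_frattini_of_single_sub_one_mem [CharP k p] (h : IsFrattiniClass cl) {u : P}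
    (hu : single u (1 : k) - 1 ∈ augIdeal k P ^ 2) : u ∈ frattini P := by
  by_contra hne
  obtain ⟨f, hf⟩ := exists_addMonoidHom_ne_zero_of_module (p := p)
    (mt (h.eq_zero_iff u).1 hne)
  let c : ZMod p →+* k := ZMod.castHom dvd_rfl k
  let l : P → k := fun v => c (f (cl v))
  let Λ : MonoidAlgebra k P →ₗ[k] k := (MonoidAlgebra.basis P k).constr k l
  have hΛ : ∀ v r, Λ (single v r) = r * l v := by
    intro v r
    have : (single v r : MonoidAlgebra k P) = r • MonoidAlgebra.basis P k v := by simp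
    rw [this, map_smul, Module.Basis.constr_basis, smul_eq_mul]
  have hleib : ∀ x y, Λ (x * y) = MonoidAlgebra.lift k k P 1 x * Λ y +
      Λ x * MonoidAlgebra.lift k k P 1 y := by
    intro x y
    induction x using induction_linear with
    | zero => simp
    | add x x' hx hx' => rw [add_mul, map_add, map_add, map_add, hx, hx']; ring
    | single v r =>
      induction y using induction_linear with
      | zero => simp
      | add y y' hy hy' => rw [mul_add, map_add, map_add, map_add, hy, hy']; ring
      | single w s =>
        rw [single_mul_single, hΛ, hΛ, hΛ, MonoidAlgebra.lift_single, MonoidAlgebra.lift_single,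
          show l (v * w) = l v + l w by simp only [l, h.map_mul, map_add]]
        simp only [MonoidHom.one_apply, smul_eq_mul]
        ring
  have hI : ∀ x ∈ augIdeal k P ^ 2, Λ x = 0 := by
    intro x hx
    rw [pow_two] at hx
    induction hx using Submodule.mul_induction_on' with
    | mem_mul_mem x hx y hy =>
      rw [hleib, mem_augIdeal.1 hx, mem_augIdeal.1 hy, zero_mul, mul_zero, add_zero]
    | add x _ y _ hx hy => rw [map_add, hx, hy, add_zero]
  have h0 := hI _ hu
  rw [map_sub, one_def, hΛ, hΛ, show l 1 = 0 by
    simp only [l, h.map_one, map_zero], one_mul, mul_zero,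
    sub_zero] at h0
  exact hf (c.injective (h0.trans (map_zero c).symm))

theorem exists_section [CharP k p] (h : IsFrattiniClass cl) :
    ∃ s : V →+ MonoidAlgebra k P,
      ∀ u, s (cl u) - (single u 1 - 1) ∈ augIdeal k P ^ 2 := by
  have : CharP (MonoidAlgebra k P) p := charP_of_injective_algebraMap
    (FaithfulSMul.algebraMap_injective k (MonoidAlgebra k P)) p
  let b := Module.Basis.ofVectorSpace (ZMod p) V
  choose x hx using fun i => h.surjective (b i)
  obtain ⟨s, hs⟩ := exists_addMonoidHom_eq_on_basis b
    (fun y : MonoidAlgebra k P => by rw [nsmul_eq_mul, CharP.cast_eq_zero, zero_mul])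
    (fun i => single (x i) 1 - 1)
  -- Agreement with u ↦ u - 1 modulo I² is additive, so it only has to be checked on the basis.
  let W : AddSubgroup V :=
    { carrier := {v | ∃ u, cl u = v ∧ s v - (single u 1 - 1) ∈ augIdeal k P ^ 2}
      zero_mem' := ⟨1, h.map_one, by rw [map_zero, ← one_def]; simp⟩
      add_mem' := by
        rintro _ _ ⟨u, rfl, hu⟩ ⟨v, rfl, hv⟩
        refine ⟨u * v, h.map_mul u v, ?_⟩
        have := sub_mem (add_mem hu hv) (single_mul_sub_one_modEq (k := k) u v)
        convert this using 1
        rw [map_add]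
        abel
      neg_mem' := by
        rintro _ ⟨u, rfl, hu⟩
        refine ⟨u⁻¹, h.map_inv u, ?_⟩
        have := add_mem (neg_mem hu) (single_mul_sub_one_modEq (k := k) u u⁻¹)
        rw [mul_inv_cancel, ← one_def] at this
        convert this using 1
        rw [map_neg]
        abel }
  have hW : AddSubgroup.toZModSubmodule p W = ⊤ := by
    rw [← top_le_iff, ← b.span_eq, Submodule.span_le]
    rintro _ ⟨i, rfl⟩
    refine ⟨x i, hx i, ?_⟩
    rw [hs, sub_self]
    exact zero_mem _
  refine ⟨s, fun u => ?_⟩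
  obtain ⟨v, hv, hsv⟩ : cl u ∈ W := by
    change cl u ∈ AddSubgroup.toZModSubmodule p W
    rw [hW]
    trivial
  have := sub_mem hsv (h.single_sub_one_modEq (k := k) (p := p) hv.symm)
  convert this using 1
  abel

end IsFrattiniClass

end Frattini

/-! ### Derivations lifting endomorphisms of the Frattini quotient -/

namespace SemidirectAlgebra

variable {k P E V : Type*} [Field k] [CommGroup P] [Group E] {φ : E →* MulAut P}
  [AddCommGroup V] {cl : P → V} {p : ℕ} [Fact p.Prime] [Module (ZMod p) V]

/-- The derivation `f` of `k(P ⋊ E)` vanishes on `E`, preserves `kP`, and induces the endomorphism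
`a` of the Frattini quotient. -/
def IsLift (cl : P → V) (a : Module.End (ZMod p) V) (f : DerAlg k (SemidirectAlgebra k φ)) : Prop :=
  (∀ e, f.1 (grp k φ e) = 0) ∧ ∀ u, ∃ w y, a (cl u) = cl w ∧
    f.1 (emb k φ (single u 1)) = emb k φ y ∧ y - (single w 1 - 1) ∈ augIdeal k P ^ 2

namespace IsLift

variable {a b : Module.End (ZMod p) V} {f g : DerAlg k (SemidirectAlgebra k φ)}

theorem mem_derFil (hf : IsLift cl a f) : f ∈ derFil k φ 0 := by
  refine ⟨hf.1, fun u => ?_⟩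
  obtain ⟨w, y, -, hy, hyw⟩ := hf.2 u
  rw [hy]
  refine emb_mem_fil ?_
  rw [zero_add, pow_one, ← sub_add_cancel y (single w 1 - 1)]
  exact add_mem (Ideal.pow_le_self two_ne_zero hyw) (single_sub_one_mem_augIdeal w)

theorem exists_emb (hf : IsLift cl a f) (x : MonoidAlgebra k P) :
    ∃ y, f.1 (emb k φ x) = emb k φ y := by
  induction x using induction_linear with
  | zero => exact ⟨0, by simp⟩
  | add x x' hx hx' =>
    obtain ⟨y, hy⟩ := hx
    obtain ⟨y', hy'⟩ := hx'
    exact ⟨y + y', by rw [map_add, map_add, map_add, hy, hy']⟩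
  | single u r =>
    obtain ⟨w, y, -, hy, -⟩ := hf.2 u
    refine ⟨r • y, ?_⟩
    have : (single u r : MonoidAlgebra k P) = r • single u 1 := by simp
    rw [this, map_smul, map_smul, map_smul, hy]

theorem exists_emb_mem [Finite E] (hf : IsLift cl a f) {x : MonoidAlgebra k P}
    (hx : x ∈ augIdeal k P ^ 2) :
    ∃ y ∈ augIdeal k P ^ 2, f.1 (emb k φ x) = emb k φ y := by
  obtain ⟨y, hy⟩ := hf.exists_emb x
  have := der_mem_fil hf.mem_derFil (emb_mem_fil (φ := φ) hx)
  rw [hy] at this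
  exact ⟨y, emb_mem_fil_iff.1 this, hy⟩

theorem exists_comp [Finite E] (hf : IsLift cl a f) (hg : IsLift cl b g) (u : P) :
    ∃ w y, a (b (cl u)) = cl w ∧ f.1 (g.1 (emb k φ (single u 1))) = emb k φ y ∧
      y - (single w 1 - 1) ∈ augIdeal k P ^ 2 := by
  obtain ⟨w, y, hw, hy, hyw⟩ := hg.2 u
  obtain ⟨w', y', hw', hy', hyw'⟩ := hf.2 w
  obtain ⟨z, hz, hfz⟩ := hf.exists_emb_mem hyw
  refine ⟨w', y' + z, by rw [hw, hw'], ?_, ?_⟩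
  · have : y = (y - (single w 1 - 1)) + (single w 1 - 1) := by abel
    rw [hy, this, map_add (emb k φ), map_add, hfz, map_sub (emb k φ), map_one (emb k φ), map_sub,
      DerAlg.map_one, hy', sub_zero, ← map_add, add_comm]
  · have := add_mem hyw' hz
    convert this using 1
    abel

theorem lie [Finite E] (h : IsFrattiniClass cl) (hf : IsLift cl a f) (hg : IsLift cl b g) :
    IsLift cl (a * b - b * a) ⁅f, g⁆ := by
  refine ⟨fun e => by rw [DerAlg.lie_apply, hf.1, hg.1, map_zero, map_zero, sub_zero], fun u => ?_⟩
  obtain ⟨w, y, hw, hy, hyw⟩ := exists_comp hf hg u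
  obtain ⟨w', y', hw', hy', hyw'⟩ := exists_comp hg hf u
  refine ⟨w * w'⁻¹, y - y', ?_, ?_, ?_⟩
  · rw [LinearMap.sub_apply, Module.End.mul_apply, Module.End.mul_apply, hw, hw', h.map_mul,
      h.map_inv, sub_eq_add_neg]
  · rw [DerAlg.lie_apply, hy, hy', map_sub]
  · have h1 := single_mul_sub_one_modEq (k := k) (w * w'⁻¹) w'
    rw [inv_mul_cancel_right] at h1
    have := add_mem (sub_mem hyw hyw') h1
    convert this using 1
    abel

/-- As kP is commutative, cu - uc has coefficient 0 at the identity of E; so w - 1 ∈ I² and w ∈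
Φ(P). -/
theorem eq_zero_of_innerDer [CharP k p] (h : IsFrattiniClass cl) (hf : IsLift cl a f)
    (hinner : f ∈ IDerAlg k (SemidirectAlgebra k φ)) : a = 0 := by
  obtain ⟨c, hc⟩ := hinner
  refine LinearMap.ext fun v => ?_
  obtain ⟨u, rfl⟩ := h.surjective v
  obtain ⟨w, y, hw, hy, hyw⟩ := hf.2 u
  have h1 := congrArg (coef k φ 1) ((hc _).symm.trans hy)
  rw [map_sub, coef_mul_emb, coef_emb_mul, act_one, AlgHom.id_apply, mul_comm, sub_self,
    coef_one_emb] at h1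
  rw [← h1, zero_sub, neg_mem_iff] at hyw
  rw [hw, LinearMap.zero_apply, h.eq_zero_iff]
  exact h.mem_frattini_of_single_sub_one_mem (k := k) (p := p) hyw

end IsLift

/-! ### Construction of lifts -/

variable (k φ) in
/-- The linear endomorphism of `k(P ⋊ E)` given by `u g ↦ δ(u) u g`. -/
noncomputable def derOfHom (δ : P → MonoidAlgebra k P) : Module.End k (SemidirectAlgebra k φ) :=
  (MonoidAlgebra.basis (P ⋊[φ] E) k).constr k fun g => emb k φ (δ g.left) * single g 1

theorem derOfHom_single (δ : P → MonoidAlgebra k P) (g : P ⋊[φ] E) (r : k) :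
    derOfHom k φ δ (single g r) = emb k φ (δ g.left) * single g r := by
  have : single g r = r • (MonoidAlgebra.basis (P ⋊[φ] E) k) g := by
    rw [MonoidAlgebra.basis_apply, smul_single, smul_eq_mul, mul_one]
  rw [this, map_smul, derOfHom, Module.Basis.constr_basis, MonoidAlgebra.basis_apply,
    mul_smul_comm]

theorem single_eq_emb_mul_grp (g : P ⋊[φ] E) (r : k) :
    single g r = emb k φ (single g.left r) * grp k φ g.right := by
  simp [grp_apply]

theorem single_mul_emb (g : P ⋊[φ] E) (r : k) (x : MonoidAlgebra k P) :
    single g r * emb k φ x = emb k φ (act k φ g.right x) * single g r := by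
  rw [single_eq_emb_mul_grp, mul_assoc, grp_mul_emb, ← mul_assoc, ← mul_assoc, ← map_mul,
    ← map_mul, mul_comm]

theorem derOfHom_mem (δ : P → MonoidAlgebra k P) (hmul : ∀ u v, δ (u * v) = δ u + δ v)
    (hact : ∀ e u, δ (φ e u) = act k φ e (δ u)) :
    derOfHom k φ δ ∈ DerAlg k (SemidirectAlgebra k φ) := by
  intro a b
  induction a using induction_linear with
  | zero => simp
  | add a a' ha ha' => simp only [add_mul, map_add, ha, ha']; abel
  | single g r =>
    induction b using induction_linear with
    | zero => simp
    | add b b' hb hb' => simp only [mul_add, map_add, hb, hb']; abel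
    | single h s =>
      rw [derOfHom_single, derOfHom_single, ← mul_assoc, single_mul_emb, mul_assoc, mul_assoc,
        single_mul_single, derOfHom_single, SemidirectProduct.mul_left, hmul, hact, map_add,
        add_mul]

/-- The derivation is u ↦ δ(u)u, where δ is a lifted to I through the section. The section is
equivariant only modulo I², so δ is averaged over E, which does not change it modulo I². The factor
u is harmless since δ(u)(u - 1) ∈ I². -/
theorem exists_isLift [CharP k p] [Finite E] (hE : ¬ p ∣ Nat.card E) (h : IsFrattiniClass cl)
    (a : Module.End (ZMod p) V)
    (hcomm : ∀ e u w, a (cl u) = cl w → a (cl (φ e u)) = cl (φ e w)) :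
    ∃ f : DerAlg k (SemidirectAlgebra k φ), IsLift cl a f := by
  have := Fintype.ofFinite E
  have hE' : (Fintype.card E : k) ≠ 0 := by
    rwa [Ne, CharP.cast_eq_zero_iff k p, ← Nat.card_eq_fintype_card]
  obtain ⟨s, hs⟩ := h.exists_section (k := k) (p := p)
  let δ : P → MonoidAlgebra k P := fun u =>
    (Fintype.card E : k)⁻¹ • ∑ e, act k φ e (s (a (cl (φ e⁻¹ u))))
  have hmul : ∀ u v, δ (u * v) = δ u + δ v := by
    intro u v
    simp only [δ, map_mul, h.map_mul, map_add, Finset.sum_add_distrib, smul_add]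
  have hact : ∀ e u, δ (φ e u) = act k φ e (δ u) := by
    intro e u
    simp only [δ, map_smul, map_sum, act_act]
    congr 1
    rw [← (Group.mulLeft_bijective e).sum_comp fun g => act k φ g (s (a (cl (φ g⁻¹ (φ e u)))))]
    refine Finset.sum_congr rfl fun g _ => ?_
    rw [← MulAut.mul_apply, ← map_mul, mul_inv_rev, inv_mul_cancel_right]
  have hδ : ∀ u w, a (cl u) = cl w → δ u - (single w 1 - 1) ∈ augIdeal k P ^ 2 := by
    intro u w hw
    have h1 : δ u - (single w 1 - 1) = (Fintype.card E : k)⁻¹ •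
        ∑ e, (act k φ e (s (a (cl (φ e⁻¹ u)))) - (single w 1 - 1)) := by
      rw [Finset.sum_sub_distrib, smul_sub, inv_card_smul_sum_const hE']
    rw [h1]
    refine Submodule.smul_of_tower_mem _ _ (Submodule.sum_mem _ fun e _ => ?_)
    have h2 := act_mem_augIdeal_pow φ e 2 (hs (φ e⁻¹ w))
    rwa [map_sub, map_sub, act_single, map_one (act k φ e), ← hcomm e⁻¹ u w hw, map_inv,
      MulAut.apply_inv_self, ← map_inv] at h2
  refine ⟨⟨derOfHom k φ δ, derOfHom_mem δ hmul hact⟩, fun e => ?_, fun u => ?_⟩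
  · have h1 : δ 1 = 0 := by simpa using hmul 1 1
    change derOfHom k φ δ (grp k φ e) = 0
    rw [grp_apply, derOfHom_single, SemidirectProduct.left_inr, h1, map_zero, zero_mul]
  · obtain ⟨w, hw⟩ := h.surjective (a (cl u))
    refine ⟨w, δ u * single u 1, hw.symm, ?_, ?_⟩
    · change derOfHom k φ δ (emb k φ (single u 1)) = _
      rw [emb_single, derOfHom_single, SemidirectProduct.left_inl, map_mul, emb_single]
    · have h1 := hδ u w hw.symm
      have h2 : δ u ∈ augIdeal k P := by
        rw [← sub_add_cancel (δ u) (single w 1 - 1)]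
        exact add_mem (Ideal.pow_le_self two_ne_zero h1) (single_sub_one_mem_augIdeal w)
      have h3 := Ideal.mul_mem_mul h2 (single_sub_one_mem_augIdeal (k := k) u)
      rw [← pow_two] at h3
      have := add_mem h1 h3
      convert this using 1
      ring

theorem not_isSolvable_of_sl2 [CharP k p] [Finite E] (hp : p ≠ 2) (hE : ¬ p ∣ Nat.card E)
    (h : IsFrattiniClass cl) {x y z : Module.End (ZMod p) V} (hx : x ≠ 0)
    (hxy : x * y - y * x = z) (hzx : z * x - x * z = x + x) (hzy : z * y - y * z = -(y + y))
    (hxc : ∀ e u w, x (cl u) = cl w → x (cl (φ e u)) = cl (φ e w))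
    (hyc : ∀ e u w, y (cl u) = cl w → y (cl (φ e u)) = cl (φ e w)) :
    ¬ LieAlgebra.IsSolvable (HHOne k (SemidirectAlgebra k φ)) := by
  have h2 : (2 : ZMod p) ≠ 0 := by
    intro h2
    have : ((2 : ℕ) : ZMod p) = 0 := by exact_mod_cast h2
    rw [ZMod.natCast_eq_zero_iff] at this
    exact hp ((Nat.prime_dvd_prime_iff_eq Fact.out Nat.prime_two).1 this)
  let π : DerAlg k (SemidirectAlgebra k φ) →ₗ[k] HHOne k (SemidirectAlgebra k φ) :=
    (IDerAlg k (SemidirectAlgebra k φ)).toSubmodule.mkQ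
  have hπ : ∀ f g : DerAlg k (SemidirectAlgebra k φ), ⁅π f, π g⁆ = π ⁅f, g⁆ := fun f g => rfl
  let D := LieAlgebra.derivedSeries k (HHOne k (SemidirectAlgebra k φ))
  -- The n-th derived term contains the class of a lift of some non-zero 𝔽_p-multiple of a.
  -- Multiples are allowed because each bracket introduces a factor such as 2.
  let L : ℕ → Module.End (ZMod p) V → Prop := fun n a =>
    ∃ r : ZMod p, r ≠ 0 ∧ ∃ f : DerAlg k (SemidirectAlgebra k φ), IsLift cl (r • a) f ∧ π f ∈ D n
  have hL : ∀ n a b c, ∀ s : ZMod p, s ≠ 0 → a * b - b * a = s • c → L n a → L n b → L (n + 1) c := by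
    rintro n a b c s hs hab ⟨r, hr, f, hf, hfD⟩ ⟨r', hr', g, hg, hgD⟩
    refine ⟨r * r' * s, mul_ne_zero (mul_ne_zero hr hr') hs, ⁅f, g⁆, ?_, ?_⟩
    · have := hf.lie h hg
      rwa [smul_mul_smul_comm, smul_mul_smul_comm, mul_comm r' r, ← smul_sub, hab, smul_smul]
        at this
    · rw [← hπ]
      change _ ∈ LieAlgebra.derivedSeriesOfIdeal k _ (n + 1) ⊤
      rw [LieAlgebra.derivedSeriesOfIdeal_succ]
      exact LieSubmodule.lie_mem_lie hfD hgD
  have key : ∀ n, L n x ∧ L n y ∧ L n z := by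
    intro n
    induction n with
    | zero =>
      obtain ⟨f, hf⟩ := exists_isLift (k := k) hE h x hxc
      obtain ⟨g, hg⟩ := exists_isLift (k := k) hE h y hyc
      refine ⟨⟨1, one_ne_zero, f, by rwa [one_smul], LieSubmodule.mem_top _⟩,
        ⟨1, one_ne_zero, g, by rwa [one_smul], LieSubmodule.mem_top _⟩,
        ⟨1, one_ne_zero, ⁅f, g⁆, ?_, LieSubmodule.mem_top _⟩⟩
      rw [one_smul, ← hxy]
      exact hf.lie h hg
    | succ n ih =>
      exact ⟨hL n z x x 2 h2 (by rw [hzx, two_smul]) ih.2.2 ih.1,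
        hL n z y y (-2) (neg_ne_zero.2 h2) (by rw [hzy, neg_smul, two_smul]) ih.2.2 ih.2.1,
        hL n x y z 1 one_ne_zero (by rw [hxy, one_smul]) ih.1 ih.2.1⟩
  intro hsol
  obtain ⟨n, hn⟩ := (LieAlgebra.isSolvable_iff k _).1 hsol
  obtain ⟨r, hr, f, hf, hfD⟩ := (key n).1
  have hf0 : π f = 0 := by
    change π f ∈ LieAlgebra.derivedSeries k _ n at hfD
    rwa [hn, LieSubmodule.mem_bot] at hfD
  exact smul_ne_zero hr hx (hf.eq_zero_of_innerDer h ((Submodule.Quotient.mk_eq_zero _).1 hf0))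

end SemidirectAlgebra

section FrattiniSl2

variable {P E : Type*} [CommGroup P] [Group E] {p : ℕ} [Fact p.Prime]

theorem isFrattiniClass_mk :
    IsFrattiniClass fun u : P => Additive.ofMul (u : P ⧸ frattini P) where
  map_mul _ _ := rfl
  surjective x := QuotientGroup.mk_surjective x.toMul
  eq_zero_iff u := QuotientGroup.eq_one_iff u

variable [Finite P]

theorem frattiniQuotientMultiplicityFree_of_isSolvable {k : Type*} [Field k] [CharP k p]
    [Finite E] (hp : p ≠ 2) (hP : IsPGroup p P) (hE : ¬ p ∣ Nat.card E) (φ : E →* MulAut P)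
    (hsol : LieAlgebra.IsSolvable (HHOne k (SemidirectAlgebra k φ))) :
    FrattiniQuotientMultiplicityFree hP φ := by
  let := frattiniQuotientModule hP
  set ρ := frattiniQuotientRep hP φ with hρ
  by_contra hmf
  -- This activates Maschke's theorem, making P/Φ(P) semisimple.
  have hcard : NeZero (Nat.card E : ZMod p) := ⟨by rwa [Ne, ZMod.natCast_eq_zero_iff]⟩
  obtain ⟨x, y, z, hx, hxy, hzx, hzy⟩ :=
    exists_sl2_of_not_isMultiplicityFree (R := MonoidAlgebra (ZMod p) E) (M := ρ.asModule) hmf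
  let r : Module.End (MonoidAlgebra (ZMod p) E) ρ.asModule → Module.End (ZMod p) ρ.asModule :=
    fun a => a.restrictScalars (ZMod p)
  have hr : ∀ a b : Module.End (MonoidAlgebra (ZMod p) E) ρ.asModule, a = b → r a = r b :=
    fun a b h => congrArg r h
  have hcomm : ∀ (a : Module.End (MonoidAlgebra (ZMod p) E) ρ.asModule) (e : E) (u w : P),
      r a (Additive.ofMul (u : P ⧸ frattini P)) = Additive.ofMul (w : P ⧸ frattini P) →
      r a (Additive.ofMul ((φ e u : P) : P ⧸ frattini P)) =
        Additive.ofMul ((φ e w : P) : P ⧸ frattini P) := by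
    intro a e u w h
    have h1 := a.map_smul (single e 1) (ρ.asModuleEquiv.symm (Additive.ofMul (u : P ⧸ frattini P)))
    rw [Representation.single_smul, Representation.single_smul, one_smul, one_smul] at h1
    refine h1.trans ?_
    exact congrArg (ρ e) h
  refine SemidirectAlgebra.not_isSolvable_of_sl2 (k := k) (φ := φ) (V := ρ.asModule) hp hE
    isFrattiniClass_mk (x := r x) (y := r y) (z := r z) ?_ (hr _ _ hxy) (hr _ _ hzx) (hr _ _ hzy)
    (hcomm x) (hcomm y) hsol
  exact fun h0 => hx (LinearMap.ext fun m => LinearMap.congr_fun h0 m)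

end FrattiniSl2

end

theorem mainTheorem4 {p : ℕ} [Fact p.Prime] {k : Type*} [Field k] [CharP k p]
    {P E : Type*} [CommGroup P] [Finite P] [Nontrivial P] (hP : IsPGroup p P)
    [Group E] [Finite E] (hE : ¬ p ∣ Nat.card E)
    (φ : E →* MulAut P)
    (hPE : actionCommutator φ = ⊤)
    (hcentral : φ.ker ≤ Subgroup.center E)
    (hab : IsMulCommutative (E ⧸ φ.ker)) :
    (∀ c : HHOne k (MonoidAlgebra k (P ⋊[φ] E)),
      ∃ f : DerAlg k (MonoidAlgebra k (P ⋊[φ] E)),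
        LieSubmodule.Quotient.mk f = c ∧
        ∀ a, (f : Module.End k (MonoidAlgebra k (P ⋊[φ] E))) a ∈
          Ring.jacobson (MonoidAlgebra k (P ⋊[φ] E))) ∧
    (FrattiniQuotientMultiplicityFree hP φ →
      LieAlgebra.IsSolvable (HHOne k (MonoidAlgebra k (P ⋊[φ] E)))) ∧
    (p ≠ 2 → LieAlgebra.IsSolvable (HHOne k (MonoidAlgebra k (P ⋊[φ] E))) →
      FrattiniQuotientMultiplicityFree hP φ) := by
  refine ⟨fun c => ?_, fun hmf => ?_, fun hp hsol =>
    frattiniQuotientMultiplicityFree_of_isSolvable hp hP hE φ hsol⟩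
  · obtain ⟨f, hf, hfn⟩ := SemidirectAlgebra.exists_isNormalized hP hE hPE hcentral c
    exact ⟨f, hf, fun a => SemidirectAlgebra.fil_one_le_jacobson hP
      (by simpa using SemidirectAlgebra.der_apply_mem_fil hfn.1 a)⟩
  · obtain ⟨v, hv⟩ := exists_isActionGenerator hP φ hmf
    refine SemidirectAlgebra.isSolvable_of_isActionGenerator hP hE hPE hcentral
      (fun e g => ?_) hv
    have h := hab.is_comm.comm (e : E ⧸ φ.ker) (g : E ⧸ φ.ker)
    rw [← QuotientGroup.mk_mul, ← QuotientGroup.mk_mul, QuotientGroup.eq] at h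
    rw [MonoidHom.mem_ker, map_mul, map_inv, inv_mul_eq_one] at h
    exact h
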